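/- **Theorem 3 (high-dimensional sparse linear classification with the hinge loss).** Let $(X,Y)$ be a random pair with law $\mathbb P$ on $\mathbb R^d\times\{-1,1\}$, and let $D_n=\{(X_i,Y_i)\}_{i\le n}$ be an i.i.d. sample from $\mathbb P$. Put $p(x)=\mathbb P(Y=1\mid X=x)$, $\eta^*(x)=\mathrm{sign}(p(x)-1/2)$ and $R^*_{0/1}=\mathbb P(Y\ne\eta^*(X))$, where $\mathrm{sign}$ takes values in $\{-1,1\}$ with $\mathrm{sign}(0)=1$. For $\theta\in\mathbb R^d$ let $R_{0/1}(\theta)$ be either $\mathbb P(Y\ne \mathrm{sign}(\theta^\top X))$ or $\mathbb P(Y\,\theta^\top X<0)$; the claims hold for both. Let $\phi(y,t)=(1-yt)_+$, $R^h(\theta)=\mathbb E\,\phi(Y,\theta^\top X)$ and $r^h_n(\theta)=\frac1n\sum_{i=1}^n\phi(Y_i,\theta^\top X_i)$. Let $C_1>0$ and let $\Theta=B_1(C_1)=\{\theta\in\mathbb R^d:\|\theta\|_1\le C_1\}$. Let $L,K,B,C_{\rm x}>0$ and assume: 1. $\mathbb E\|X\|_2\le C_{\rm x}$. 2. (Target.)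 $\theta^*\in\Theta$ minimizes $R^h$ over $\Theta$ and is ideal for the hinge loss: $R^h(\theta^*)\le\mathbb E\,\phi(Y,f(X))$ for every measurable $f:\mathbb R^d\to\mathbb R$. With $s^*=\|\theta^*\|_0$ the number of nonzero coordinates of $\theta^*$, $s^*<n<d$. 3. (Bounded and Lipschitz loss.) Almost surely, for all $\theta,\theta'\in\Theta$: $0\le \phi(Y,\theta^\top X)\le B$ and $|\phi(Y,\theta^\top X)-\phi(Y,\theta'^\top X)|\le L\|\theta-\theta'\|_2$. 4. (Bernstein condition.) $\|\theta-\theta^*\|_2^2\le K\,[R^h(\theta)-R^h(\theta^*)]$ for all $\theta\in\Theta$. 5. (Margin condition.) $\mathbb P\{0<|p(X)-1/2|<1/(2c)\}=0$ for some $c>0$. Let $\pi$ be the probability measure on $\Theta$ with Lebesgue density proportional to $\prod_{i=1}^d(\tau^2+\theta_i^2)^{-2}$ on $\Theta$ (the scaled Student prior with 3 degrees of freedom), where $C_1>2d\tau$ and either (a) $\tau=(C_{\rm x}\,n\sqrt d)^{-1}$ and $\|\theta^*\|_1\le C_1-2d\tau$, or (b) $\tau=(C_{\rm x}\,n\,d)^{-1}$.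 Let $\lambda=n/\max(2L^2K,B)$, let $\hat\rho^h_\lambda(d\theta)\propto\exp[-\lambda r^h_n(\theta)]\,\pi(d\theta)$ be the Gibbs posterior and $\hat\theta=\int\theta\,\hat\rho^h_\lambda(d\theta)$ its mean. Then $$\mathbb E\big[\mathbb E_{\theta\sim\hat\rho^h_\lambda}[R_{0/1}(\theta)]\big]-R^*_{0/1}\le C\,\frac{s^*\log(d/s^*)}{n}\qquad\text{and}\qquad \mathbb E\big[R_{0/1}(\hat\theta)\big]-R^*_{0/1}\le C\,\frac{s^*\log(d/s^*)}{n},$$ where $C>0$ depends only on $L,K,B,C_1,C_{\rm x}$ (and $s^*\log(d/s^*)$ is read as $0$ when $s^*=0$). -/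

import Mathlib

open MeasureTheory ProbabilityTheory

noncomputable section

namespace SparseClassification

/-- The space of covariates and of parameters, with the Euclidean norm. -/
abbrev Vec (d : ℕ) : Type := EuclideanSpace ℝ (Fin d)

/-- A labelled observation `(x, y)`; laws are required to charge only `y = 1` and `y = -1`. -/
abbrev Obs (d : ℕ) : Type := Vec d × ℝ

/-- The sign with values in `{-1, 1}`. -/
def sgn (t : ℝ) : ℝ := if 0 ≤ t then 1 else -1

/-- The number of nonzero coordinates. -/
def l0 {d : ℕ} (θ : Vec d) : ℕ := (Finset.univ.filter fun i => θ i ≠ 0).card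

/-- The `ℓ¹` norm. -/
def l1 {d : ℕ} (θ : Vec d) : ℝ := ∑ i, |θ i|

/-- The closed `ℓ¹` ball of radius `C₁`; this is the parameter set `Θ`. -/
def ballL1 (d : ℕ) (C₁ : ℝ) : Set (Vec d) := {θ | l1 θ ≤ C₁}

/-- The regression function `p(x) = P(Y = 1 | X = x)`. -/
def regression {d : ℕ} (P : Measure (Obs d)) [IsFiniteMeasure P] (x : Vec d) : ℝ :=
  (P.condKernel x).real {1}

/-- The Bayes classifier `sign (p(x) - 1/2)`. -/
def bayesClassifier {d : ℕ} (P : Measure (Obs d)) [IsFiniteMeasure P] (x : Vec d) : ℝ :=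
  sgn (regression P x - 1 / 2)

/-- The misclassification risk of the Bayes classifier. -/
def bayesRisk {d : ℕ} (P : Measure (Obs d)) [IsFiniteMeasure P] : ℝ :=
  P.real {z | z.2 ≠ bayesClassifier P z.1}

/-- The misclassification risk `P(Y ≠ sign ⟨θ, X⟩)` of the linear classifier of `θ`. -/
def misclassRisk {d : ℕ} (P : Measure (Obs d)) (θ : Vec d) : ℝ :=
  P.real {z | z.2 ≠ sgn (inner ℝ θ z.1)}

/-- The prediction risk `P(Y ⟨θ, X⟩ < 0)`, in which ties `⟨θ, X⟩ = 0` are not counted. -/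
def predictionRisk {d : ℕ} (P : Measure (Obs d)) (θ : Vec d) : ℝ :=
  P.real {z | z.2 * inner ℝ θ z.1 < 0}

/-- The hinge loss `(1 - y t)₊` of the score `t` for the label `y`. -/
def hinge (y t : ℝ) : ℝ := max (1 - y * t) 0

/-- The hinge risk of an arbitrary score function. -/
def scoreRisk {d : ℕ} (P : Measure (Obs d)) (f : Vec d → ℝ) : ℝ :=
  ∫ z, hinge z.2 (f z.1) ∂P

/-- The hinge risk of the linear score of `θ`. -/
def hingeRisk {d : ℕ} (P : Measure (Obs d)) (θ : Vec d) : ℝ :=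
  scoreRisk P fun x => inner ℝ θ x

/-- The empirical hinge risk on a sample. -/
def empHingeRisk {n d : ℕ} (D : Fin n → Obs d) (θ : Vec d) : ℝ :=
  (1 / (n : ℝ)) * ∑ i, hinge (D i).2 (inner ℝ θ (D i).1)

/-- `θs` is ideal for the hinge loss: no measurable score function has a smaller hinge risk. -/
def IsHingeBayes {d : ℕ} (P : Measure (Obs d)) (θs : Vec d) : Prop :=
  ∀ f : Vec d → ℝ, Measurable f → Integrable (fun z : Obs d => hinge z.2 (f z.1)) P →
    hingeRisk P θs ≤ scoreRisk P f

/-- The unnormalized density of the scaled Student prior with three degrees of freedom. -/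
def studentWeight {d : ℕ} (τ : ℝ) (θ : Vec d) : ℝ := ∏ i, ((τ ^ 2 + θ i ^ 2) ^ 2)⁻¹

/-- The scaled Student prior restricted to the `ℓ¹` ball and normalized. -/
def prior (d : ℕ) (C₁ τ : ℝ) : Measure (Vec d) :=
  (volume.restrict (ballL1 d C₁)).withDensity fun θ =>
    ENNReal.ofReal (studentWeight τ θ / ∫ t in ballL1 d C₁, studentWeight τ t)

/-- The Gibbs posterior: the probability measure with density proportional to
`exp (-lam * r(θ))` with respect to the prior, where `r` is the empirical hinge risk. -/
def gibbs {n d : ℕ} (C₁ τ lam : ℝ) (D : Fin n → Obs d) : Measure (Vec d) :=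
  (prior d C₁ τ).tilted fun θ => -lam * empHingeRisk D θ

/-- The mean of the Gibbs posterior. -/
def posteriorMean {n d : ℕ} (C₁ τ lam : ℝ) (D : Fin n → Obs d) : Vec d :=
  ∫ θ, θ ∂(gibbs C₁ τ lam D)

/-- The law of an i.i.d. sample of size `n`. -/
def sampleLaw {d : ℕ} (P : Measure (Obs d)) (n : ℕ) : Measure (Fin n → Obs d) :=
  Measure.pi fun _ => P

end SparseClassification

end

/-!
A linear score that is ideal for the hinge loss classifies as well as the Bayes rule. Comparing it
with its truncations shows moreover that where `|⟨θs, X⟩| < 1/2` every labelling is as good as any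
other. The Lipschitz condition forces `‖X‖ ≤ L` almost surely, so every `θ` within `1 / (2 * L)` of
`θs` attains the Bayes risk, and the excess risks of the posterior and of its mean are at most a
multiple of the posterior mass of `{θ | 1 / (4 * L) ≤ ‖θ - θs‖}`.

By the Bernstein condition the variance of the excess loss is at most proportional to its mean, so
the exponential moments of far parameters decay exponentially in `n`. The normalizing constant is
bounded below by the prior mass of a small ball around a hard thresholding of `θs`, whose sparsity
depends only on the accuracy; this mass is at least a negative power of `n * d`. Finally
`(n * d) ^ j * exp (-α * n)`, capped at `1`, is at most a constant times `s * log (d / s) / n`.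
-/

noncomputable section

namespace SparseClassification

open Filter
open scoped Topology

section Classification

lemma measurable_sgn : Measurable sgn :=
  Measurable.ite measurableSet_Ici measurable_const measurable_const

lemma abs_sgn (t : ℝ) : |sgn t| = 1 := by
  unfold sgn; split_ifs <;> simp

lemma sgn_eq_of_abs_sub_lt {s t : ℝ} (h : |t - s| < |s|) : sgn t = sgn s := by
  unfold sgn
  rcases abs_cases (t - s) with h₁ | h₁ <;> rcases abs_cases s with h₂ | h₂ <;> grind

lemma measurable_bayesClassifier {d : ℕ} (P : Measure (Obs d)) [IsFiniteMeasure P] :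
    Measurable (bayesClassifier P) :=
  measurable_sgn.comp <| Measurable.sub_const
    (P.condKernel.measurable_coe (measurableSet_singleton 1)).ennreal_toReal _

lemma predictionRisk_le_misclassRisk {d : ℕ} (P : Measure (Obs d)) [IsFiniteMeasure P]
    (θ : Vec d) : predictionRisk P θ ≤ misclassRisk P θ := by
  refine measureReal_mono fun z (hz : z.2 * inner ℝ θ z.1 < 0) (h : z.2 = _) => ?_
  rw [h, sgn] at hz
  split_ifs at hz <;> linarith

lemma hinge_nonneg (y t : ℝ) : 0 ≤ hinge y t := le_max_right _ _

lemma hinge_eq_of_abs_le_one {y t : ℝ} (hy : |y| = 1) (ht : |t| ≤ 1) : hinge y t = 1 - y * t := by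
  refine max_eq_left (sub_nonneg.2 ((le_abs_self _).trans ?_))
  rwa [abs_mul, hy, one_mul]

lemma continuous_hinge_inner {d : ℕ} :
    Continuous fun q : Vec d × Obs d => hinge q.2.2 (inner ℝ q.1 q.2.1) := by
  unfold hinge; fun_prop

/-- The truncation of a real score to the interval `[-1, 1]`, on which the hinge loss is affine. -/
def clip (t : ℝ) : ℝ := max (-1) (min 1 t)

lemma abs_clip_le_one (t : ℝ) : |clip t| ≤ 1 :=
  abs_le.2 ⟨le_max_left _ _, max_le (by norm_num) (min_le_left _ _)⟩

lemma hinge_clip_le {y : ℝ} (hy : |y| = 1) (t : ℝ) : hinge y (clip t) ≤ hinge y t := by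
  rw [hinge_eq_of_abs_le_one hy (abs_clip_le_one t), hinge, clip]
  rcases (abs_eq zero_le_one).1 hy with rfl | rfl <;> grind

lemma abs_clip_sub_le_one {t g : ℝ} (hg : |g| = 1) (h : 1 / 2 ≤ |t| → g = sgn t) :
    |clip t - (g - clip t) / 4| ≤ 1 := by
  have hg' := (abs_eq zero_le_one).1 hg
  unfold clip
  unfold sgn at h
  rw [abs_le]
  rcases le_or_gt (1 / 2) |t| with ht | ht
  · have := h ht
    rw [le_abs] at ht
    grind
  · rw [abs_lt] at ht
    rw [min_eq_right (by linarith), max_eq_right (by linarith)]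
    rcases hg' with rfl | rfl <;> constructor <;> linarith

section LabelCorrelation

variable {𝒳 : Type*} [MeasurableSpace 𝒳]

/-- The correlation `E[Y f(X)]` of a score with the label. For scores with values in `[-1, 1]` the
hinge risk, and for classifiers the misclassification risk, is an affine function of it. -/
def labelCorrelation (P : Measure (𝒳 × ℝ)) (f : 𝒳 → ℝ) : ℝ := ∫ z, z.2 * f z.1 ∂P

variable {P : Measure (𝒳 × ℝ)} {f g : 𝒳 → ℝ}

lemma integrable_label_mul [IsFiniteMeasure P] (hlab : ∀ᵐ z ∂P, |z.2| = 1) (hf : Measurable f)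
    (hf₁ : ∀ᵐ z ∂P, |f z.1| ≤ 1) : Integrable (fun z => z.2 * f z.1) P := by
  refine Integrable.of_bound (C := 1) (by fun_prop) ?_
  filter_upwards [hlab, hf₁] with z hz h₁
  rwa [Real.norm_eq_abs, abs_mul, hz, one_mul]

lemma labelCorrelation_sub_div [IsFiniteMeasure P] (hlab : ∀ᵐ z ∂P, |z.2| = 1)
    (hf : Measurable f) (hf₁ : ∀ᵐ z ∂P, |f z.1| ≤ 1) (hg : Measurable g)
    (hg₁ : ∀ᵐ z ∂P, |g z.1| ≤ 1) (a : ℝ) :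
    labelCorrelation P (fun x => f x - (g x - f x) / a) =
      labelCorrelation P f - (labelCorrelation P g - labelCorrelation P f) / a := by
  have hfi := integrable_label_mul hlab hf hf₁
  have hgi := integrable_label_mul hlab hg hg₁
  have hgfi : Integrable (fun z => (z.2 * g z.1 - z.2 * f z.1) / a) P := (hgi.sub hfi).div_const a
  simp only [labelCorrelation]
  rw [← integral_sub hgi hfi, ← integral_div, ← integral_sub hfi hgfi]
  exact integral_congr_ae (.of_forall fun z => by ring)

lemma measureReal_label_ne [IsProbabilityMeasure P] (hlab : ∀ᵐ z ∂P, |z.2| = 1)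
    (hg : Measurable g) (hg₁ : ∀ x, |g x| = 1) :
    P.real {z | z.2 ≠ g z.1} = (1 - labelCorrelation P g) / 2 := by
  have hm : MeasurableSet {z : 𝒳 × ℝ | z.2 ≠ g z.1} :=
    (measurableSet_eq_fun measurable_snd (hg.comp measurable_fst)).compl
  have hind : Set.indicator {z : 𝒳 × ℝ | z.2 ≠ g z.1} (1 : 𝒳 × ℝ → ℝ) =ᵐ[P]
      fun z => (1 - z.2 * g z.1) / 2 := by
    filter_upwards [hlab] with z hz
    rw [abs_eq zero_le_one] at hz
    simp only [Set.indicator_apply, Set.mem_ofPred_eq, Pi.one_apply]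
    rcases hz with hz | hz <;> rcases (abs_eq zero_le_one).1 (hg₁ z.1) with h | h <;>
      rw [hz, h] <;> norm_num
  rw [← integral_indicator_one hm, integral_congr_ae hind, integral_div,
    integral_sub (integrable_const _)
      (integrable_label_mul hlab hg (.of_forall fun z => (hg₁ z.1).le))]
  simp [labelCorrelation]

end LabelCorrelation

variable {d : ℕ} {P : Measure (Obs d)} {θs θ : Vec d}

lemma measurable_clip_inner (θ : Vec d) : Measurable fun x : Vec d => clip (inner ℝ θ x) := by
  unfold clip; fun_prop

lemma hinge_ae_eq_of_abs_le_one {f : Vec d → ℝ} (hlab : ∀ᵐ z ∂P, |z.2| = 1)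
    (hf₁ : ∀ᵐ z ∂P, |f z.1| ≤ 1) :
    (fun z : Obs d => hinge z.2 (f z.1)) =ᵐ[P] fun z => 1 - z.2 * f z.1 := by
  filter_upwards [hlab, hf₁] with z hz h₁ using hinge_eq_of_abs_le_one hz h₁

variable [IsProbabilityMeasure P]

lemma scoreRisk_eq_one_sub_labelCorrelation {f : Vec d → ℝ} (hlab : ∀ᵐ z ∂P, |z.2| = 1)
    (hf : Measurable f) (hf₁ : ∀ᵐ z ∂P, |f z.1| ≤ 1) :
    scoreRisk P f = 1 - labelCorrelation P f := by
  rw [scoreRisk, integral_congr_ae (hinge_ae_eq_of_abs_le_one hlab hf₁),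
    integral_sub (integrable_const _) (integrable_label_mul hlab hf hf₁)]
  simp [labelCorrelation]

lemma IsHingeBayes.labelCorrelation_le (hbayes : IsHingeBayes P θs)
    (hint : Integrable (fun z : Obs d => hinge z.2 (inner ℝ θs z.1)) P)
    (hlab : ∀ᵐ z ∂P, |z.2| = 1) {f : Vec d → ℝ} (hf : Measurable f)
    (hf₁ : ∀ᵐ z ∂P, |f z.1| ≤ 1) :
    labelCorrelation P f ≤ labelCorrelation P fun x => clip (inner ℝ θs x) := by
  have hopt : hingeRisk P θs ≤ 1 - labelCorrelation P f := by
    rw [← scoreRisk_eq_one_sub_labelCorrelation hlab hf hf₁]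
    refine hbayes f hf (Integrable.congr ?_ (hinge_ae_eq_of_abs_le_one hlab hf₁).symm)
    exact (integrable_const 1).sub (integrable_label_mul hlab hf hf₁)
  have hclip : 1 - labelCorrelation P (fun x => clip (inner ℝ θs x)) ≤ hingeRisk P θs := by
    rw [← scoreRisk_eq_one_sub_labelCorrelation hlab (measurable_clip_inner θs)
      (.of_forall fun z => abs_clip_le_one _)]
    refine integral_mono_of_nonneg (.of_forall fun z => hinge_nonneg _ _) hint ?_
    filter_upwards [hlab] with z hz using hinge_clip_le hz _
  linarith

-- Moving the clipped score `c` slightly away from the classifier `g` keeps it in `[-1, 1]`, so by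
-- optimality of `c` the correlation of `g` is at least that of `c`.
lemma IsHingeBayes.labelCorrelation_clip_le (hbayes : IsHingeBayes P θs)
    (hint : Integrable (fun z : Obs d => hinge z.2 (inner ℝ θs z.1)) P)
    (hlab : ∀ᵐ z ∂P, |z.2| = 1) {g : Vec d → ℝ} (hg : Measurable g) (hg₁ : ∀ x, |g x| = 1)
    (hagree : ∀ᵐ z ∂P, 1 / 2 ≤ |inner ℝ θs z.1| → g z.1 = sgn (inner ℝ θs z.1)) :
    labelCorrelation P (fun x => clip (inner ℝ θs x)) ≤ labelCorrelation P g := by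
  have hc := measurable_clip_inner θs
  have hle := hbayes.labelCorrelation_le hint hlab
    (f := fun x => clip (inner ℝ θs x) - (g x - clip (inner ℝ θs x)) / 4) (by fun_prop) <| by
      filter_upwards [hagree] with z hz using abs_clip_sub_le_one (hg₁ z.1) hz
  rw [labelCorrelation_sub_div hlab hc (.of_forall fun z => abs_clip_le_one _) hg
    (.of_forall fun z => (hg₁ z.1).le)] at hle
  linarith

lemma IsHingeBayes.misclassRisk_le_bayesRisk (hbayes : IsHingeBayes P θs)
    (hint : Integrable (fun z : Obs d => hinge z.2 (inner ℝ θs z.1)) P)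
    (hlab : ∀ᵐ z ∂P, |z.2| = 1)
    (hagree : ∀ᵐ z ∂P, 1 / 2 ≤ |inner ℝ θs z.1| →
      sgn (inner ℝ θ z.1) = sgn (inner ℝ θs z.1)) :
    misclassRisk P θ ≤ bayesRisk P := by
  have hg : Measurable fun x : Vec d => sgn (inner ℝ θ x) := measurable_sgn.comp (by fun_prop)
  have hb := measurable_bayesClassifier P
  have hcorr : labelCorrelation P (bayesClassifier P) ≤
      labelCorrelation P fun x => sgn (inner ℝ θ x) :=
    (hbayes.labelCorrelation_le hint hlab hb (.of_forall fun z => (abs_sgn _).le)).trans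
      (hbayes.labelCorrelation_clip_le hint hlab hg (fun _ => abs_sgn _) hagree)
  rw [misclassRisk, bayesRisk, measureReal_label_ne hlab hg fun _ => abs_sgn _,
    measureReal_label_ne hlab hb fun _ => abs_sgn _]
  linarith

lemma IsHingeBayes.misclassRisk_le_bayesRisk_of_norm_sub_lt {L : ℝ} (hbayes : IsHingeBayes P θs)
    (hint : Integrable (fun z : Obs d => hinge z.2 (inner ℝ θs z.1)) P)
    (hlab : ∀ᵐ z ∂P, |z.2| = 1) (hL : 0 < L) (hX : ∀ᵐ z ∂P, ‖z.1‖ ≤ L)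
    (hθ : ‖θ - θs‖ < 1 / (2 * L)) : misclassRisk P θ ≤ bayesRisk P := by
  refine hbayes.misclassRisk_le_bayesRisk hint hlab ?_
  filter_upwards [hX] with z hz hs
  refine sgn_eq_of_abs_sub_lt (lt_of_lt_of_le ?_ hs)
  calc |inner ℝ θ z.1 - inner ℝ θs z.1| = |inner ℝ (θ - θs) z.1| := by rw [inner_sub_left]
    _ ≤ ‖θ - θs‖ * ‖z.1‖ := abs_real_inner_le_norm _ _
    _ ≤ ‖θ - θs‖ * L := by gcongr
    _ < 1 / (2 * L) * L := by gcongr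
    _ = 1 / 2 := by field_simp

-- Near the origin the loss is `1 - y ⟨θ, x⟩`, whose gradient `-y x` has norm `‖x‖`.
lemma norm_le_of_eventually_hinge_lipschitz {E : Type*} [NormedAddCommGroup E]
    [InnerProductSpace ℝ E] {x : E} {y L : ℝ} (hy : |y| = 1) (hL : 0 ≤ L)
    (h : ∀ᶠ θ in 𝓝 (0 : E), |hinge y (inner ℝ θ x) - hinge y (inner ℝ 0 x)| ≤ L * ‖θ - 0‖) :
    ‖x‖ ≤ L := by
  have hder : HasFDerivAt (fun θ : E => 1 - y * inner ℝ x θ) (-(y • innerSL ℝ x)) 0 :=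
    (((innerSL ℝ x).hasFDerivAt).const_mul y).const_sub 1
  have hsmall : ∀ᶠ θ in 𝓝 (0 : E), |inner ℝ x θ| < 1 :=
    ContinuousAt.eventually_lt (by fun_prop) continuousAt_const (by simp)
  have hnorm : ‖-(y • innerSL ℝ x)‖ ≤ L := by
    refine hder.le_of_lip' hL ?_
    filter_upwards [h, hsmall] with θ hθ hθ₁
    rw [real_inner_comm x θ, real_inner_comm x 0, hinge_eq_of_abs_le_one hy hθ₁.le,
      hinge_eq_of_abs_le_one hy (by simp)] at hθ
    exact hθ
  rwa [norm_neg, norm_smul, innerSL_apply_norm, Real.norm_eq_abs, hy, one_mul] at hnorm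

end Classification

section Norms

variable {d : ℕ}

lemma l1_nonneg (θ : Vec d) : 0 ≤ l1 θ := Finset.sum_nonneg fun _ _ => abs_nonneg _

lemma abs_le_l1 (θ : Vec d) (i : Fin d) : |θ i| ≤ l1 θ :=
  Finset.single_le_sum (f := fun i => |θ i|) (fun _ _ => abs_nonneg _) (Finset.mem_univ i)

lemma l1_zero : l1 (0 : Vec d) = 0 := by simp [l1]

lemma l1_smul (a : ℝ) (θ : Vec d) : l1 (a • θ) = |a| * l1 θ := by
  simp [l1, abs_mul, Finset.mul_sum]

lemma l1_add_le (θ θ' : Vec d) : l1 (θ + θ') ≤ l1 θ + l1 θ' := by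
  rw [l1, l1, l1, ← Finset.sum_add_distrib]
  exact Finset.sum_le_sum fun i _ => abs_add_le (θ i) (θ' i)

lemma norm_le_l1 (θ : Vec d) : ‖θ‖ ≤ l1 θ := by
  refine le_of_sq_le_sq ?_ (l1_nonneg θ)
  rw [EuclideanSpace.real_norm_sq_eq, l1]
  simpa using Finset.sum_sq_le_sq_sum_of_nonneg (s := Finset.univ) (f := fun i => |θ i|)
    fun i _ => abs_nonneg _

lemma l1_le_sqrt_mul_norm (θ : Vec d) : l1 θ ≤ √d * ‖θ‖ := by
  refine le_of_sq_le_sq ?_ (by positivity)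
  rw [mul_pow, Real.sq_sqrt (by positivity), EuclideanSpace.real_norm_sq_eq, l1]
  simpa using sq_sum_le_card_mul_sum_sq (s := Finset.univ) (f := fun i => |θ i|)

lemma eq_zero_of_l0_eq_zero {θ : Vec d} (h : l0 θ = 0) : θ = 0 := by
  ext i
  simpa using Finset.filter_eq_empty_iff.1 (Finset.card_eq_zero.1 h) (Finset.mem_univ i)

lemma continuous_l1 : Continuous (l1 : Vec d → ℝ) := by unfold l1; fun_prop

lemma measurableSet_ballL1 (C₁ : ℝ) : MeasurableSet (ballL1 d C₁) :=
  (isClosed_le continuous_l1 continuous_const).measurableSet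

lemma ballL1_mem_nhds_zero {C₁ : ℝ} (hC₁ : 0 < C₁) : ballL1 d C₁ ∈ 𝓝 0 :=
  continuous_l1.continuousAt.preimage_mem_nhds (Iic_mem_nhds (l1_zero.trans_lt hC₁))

lemma norm_sub_le_of_mem_ballL1 {C₁ : ℝ} {θ θ' : Vec d} (hθ : θ ∈ ballL1 d C₁)
    (hθ' : θ' ∈ ballL1 d C₁) : ‖θ - θ'‖ ≤ 2 * C₁ :=
  calc ‖θ - θ'‖ ≤ ‖θ‖ + ‖θ'‖ := norm_sub_le _ _
    _ ≤ C₁ + C₁ := add_le_add ((norm_le_l1 θ).trans hθ) ((norm_le_l1 θ').trans hθ')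
    _ = 2 * C₁ := (two_mul C₁).symm

lemma closedBall_subset_ballL1 {C₁ ρ : ℝ} {v : Vec d} (hv : l1 v + √d * ρ ≤ C₁) :
    Metric.closedBall v ρ ⊆ ballL1 d C₁ := by
  intro θ hθ
  rw [Metric.mem_closedBall, dist_eq_norm] at hθ
  calc l1 θ = l1 (v + (θ - v)) := by rw [add_sub_cancel]
    _ ≤ l1 v + l1 (θ - v) := l1_add_le _ _
    _ ≤ l1 v + √d * ρ := by
      gcongr
      exact (l1_le_sqrt_mul_norm _).trans (by gcongr)
    _ ≤ C₁ := hv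

/-- The vector obtained from `v` by setting to zero the coordinates of modulus at most `h`; it is
the sparse approximation of `v` around which the prior mass is estimated. -/
def hardThreshold (h : ℝ) (v : Vec d) : Vec d :=
  WithLp.toLp 2 fun i => if h < |v i| then v i else 0

lemma l1_hardThreshold_le (h : ℝ) (v : Vec d) : l1 (hardThreshold h v) ≤ l1 v := by
  refine Finset.sum_le_sum fun i _ => ?_
  simp only [hardThreshold]
  split_ifs <;> simp

lemma l0_hardThreshold_mul_le (h : ℝ) (v : Vec d) :
    l0 (hardThreshold h v) * h ≤ l1 v := by
  have hsub : ∀ i ∈ Finset.univ.filter (fun i => hardThreshold h v i ≠ 0), h ≤ |v i| := by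
    intro i hi
    by_contra! hlt
    simp [hardThreshold, hlt.not_gt] at hi
  calc l0 (hardThreshold h v) * h
      ≤ ∑ i with hardThreshold h v i ≠ 0, |v i| := by
        rw [l0, ← nsmul_eq_mul]
        exact Finset.card_nsmul_le_sum _ _ _ hsub
    _ ≤ l1 v := Finset.sum_le_sum_of_subset_of_nonneg (Finset.subset_univ _)
        fun _ _ _ => abs_nonneg _

lemma norm_hardThreshold_sub_sq_le {h : ℝ} (hh : 0 ≤ h) (v : Vec d) :
    ‖hardThreshold h v - v‖ ^ 2 ≤ h * l1 v := by
  rw [EuclideanSpace.real_norm_sq_eq, l1, Finset.mul_sum]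
  refine Finset.sum_le_sum fun i _ => ?_
  simp only [hardThreshold, PiLp.sub_apply]
  split_ifs with hi
  · simpa using mul_nonneg hh (abs_nonneg (v i))
  · rw [zero_sub, neg_sq, ← sq_abs, sq]
    exact mul_le_mul_of_nonneg_right (not_lt.1 hi) (abs_nonneg _)

lemma exists_l0_le_floor_and_norm_sub_le {C ε : ℝ} (hC : 0 < C) (hε : 0 < ε) {v : Vec d}
    (hv : l1 v ≤ C) :
    ∃ w : Vec d, l1 w ≤ l1 v ∧ l0 w ≤ ⌊(C / ε) ^ 2⌋₊ ∧ ‖w - v‖ ≤ ε := by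
  have hh : 0 < ε ^ 2 / C := by positivity
  refine ⟨hardThreshold (ε ^ 2 / C) v, l1_hardThreshold_le _ v, Nat.le_floor ?_, ?_⟩
  · have hl0 := (l0_hardThreshold_mul_le (ε ^ 2 / C) v).trans hv
    rw [← le_div_iff₀ hh] at hl0
    exact hl0.trans_eq (by field_simp)
  · refine le_of_sq_le_sq ((norm_hardThreshold_sub_sq_le hh.le v).trans ?_) hε.le
    calc ε ^ 2 / C * l1 v ≤ ε ^ 2 / C * C := by gcongr
      _ = ε ^ 2 := by field_simp

lemma exists_l1_add_le_and_norm_sub_le {C t : ℝ} (ht : 0 ≤ t) (htC : t < C) {v : Vec d}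
    (hv : l1 v ≤ C) : ∃ w : Vec d, l1 w + t ≤ C ∧ ‖w - v‖ ≤ t := by
  have hC : 0 < C := ht.trans_lt htC
  have ha : 0 ≤ 1 - t / C := sub_nonneg.2 ((div_le_one hC).2 htC.le)
  refine ⟨(1 - t / C) • v, ?_, ?_⟩
  · rw [l1_smul, abs_of_nonneg ha]
    calc (1 - t / C) * l1 v + t ≤ (1 - t / C) * C + t := by gcongr
      _ = C := by field_simp; ring
  · rw [show (1 - t / C) • v - v = -((t / C) • v) by module, norm_neg, norm_smul,
      Real.norm_of_nonneg (by positivity)]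
    calc t / C * ‖v‖ ≤ t / C * C := by
          gcongr
          exact (norm_le_l1 v).trans hv
      _ = t := by field_simp

lemma exists_sparse_l1_add_le {C t ε δ : ℝ} (hε : 0 < ε) (ht : 0 ≤ t) (htC : t < C) {v : Vec d}
    (hv : l1 v ≤ C) (h : l1 v ≤ C - t ∨ t ≤ δ) (hδ : 0 ≤ δ) :
    ∃ w : Vec d, l1 w + t ≤ C ∧ l0 w ≤ ⌊(C / ε) ^ 2⌋₊ ∧ ‖w - v‖ ≤ ε + δ := by
  obtain ⟨v', hv', hvδ⟩ : ∃ v' : Vec d, l1 v' + t ≤ C ∧ ‖v' - v‖ ≤ δ := by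
    rcases h with h | h
    · exact ⟨v, by linarith, by simpa using hδ⟩
    · obtain ⟨w, hw, hwv⟩ := exists_l1_add_le_and_norm_sub_le ht htC hv
      exact ⟨w, hw, hwv.trans h⟩
  obtain ⟨w, hw, hw₀, hwε⟩ :=
    exists_l0_le_floor_and_norm_sub_le (ht.trans_lt htC) hε (show l1 v' ≤ C by linarith)
  exact ⟨w, by linarith, hw₀, (norm_sub_le_norm_sub_add_norm_sub w v' v).trans (by linarith)⟩

end Norms

section StudentPrior

variable {d : ℕ} {τ C₁ : ℝ}

/-- The one-dimensional factor of `studentWeight`: up to normalization, the Student density with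
three degrees of freedom and scale `τ`. -/
def studentFactor (τ x : ℝ) : ℝ := ((τ ^ 2 + x ^ 2) ^ 2)⁻¹

lemma studentWeight_eq_prod (τ : ℝ) (θ : Vec d) :
    studentWeight τ θ = ∏ i, studentFactor τ (θ i) := rfl

lemma studentFactor_pos (hτ : 0 < τ) (x : ℝ) : 0 < studentFactor τ x := by
  unfold studentFactor; positivity

lemma studentWeight_pos (hτ : 0 < τ) (θ : Vec d) : 0 < studentWeight τ θ :=
  Finset.prod_pos fun _ _ => studentFactor_pos hτ _

lemma continuous_studentFactor (hτ : 0 < τ) : Continuous (studentFactor τ) := by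
  unfold studentFactor
  exact Continuous.inv₀ (by fun_prop) fun x => by positivity

lemma integrable_inv_sq_add_sq (hτ : 0 < τ) : Integrable fun x : ℝ => (τ ^ 2 + x ^ 2)⁻¹ := by
  refine ((integrable_inv_one_add_sq.comp_div hτ.ne').const_mul (τ ^ 2)⁻¹).congr
    (.of_forall fun x => ?_)
  simp only [← mul_inv]
  congr 1
  field_simp

lemma integrable_studentFactor (hτ : 0 < τ) : Integrable (studentFactor τ) := by
  refine ((integrable_inv_sq_add_sq hτ).const_mul (τ ^ 2)⁻¹).mono'
    (continuous_studentFactor hτ).aestronglyMeasurable (.of_forall fun x => ?_)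
  rw [Real.norm_of_nonneg (studentFactor_pos hτ x).le, studentFactor, ← mul_inv, sq (_ + _)]
  gcongr
  exact le_add_of_nonneg_right (sq_nonneg x)

lemma integrable_sq_mul_studentFactor (hτ : 0 < τ) :
    Integrable fun x => x ^ 2 * studentFactor τ x := by
  refine (integrable_inv_sq_add_sq hτ).mono'
    ((continuous_pow 2).mul (continuous_studentFactor hτ)).aestronglyMeasurable
    (.of_forall fun x => ?_)
  rw [Real.norm_of_nonneg (mul_nonneg (sq_nonneg x) (studentFactor_pos hτ x).le), studentFactor,
    ← div_eq_mul_inv, div_le_iff₀ (by positivity), sq (_ + _), inv_mul_cancel_left₀ (by positivity)]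
  exact le_add_of_nonneg_left (sq_nonneg τ)

lemma tendsto_div_sq_add_sq {l : Filter ℝ} (τ : ℝ) (hl : Tendsto (fun x => |x|) l atTop) :
    Tendsto (fun x : ℝ => x / (τ ^ 2 + x ^ 2)) l (𝓝 0) := by
  refine squeeze_zero_norm' ?_ (tendsto_inv_atTop_zero.comp hl)
  filter_upwards [hl.eventually_gt_atTop 0] with x hx
  have hx₂ : 0 < x ^ 2 := sq_pos_of_pos hx |>.trans_eq (sq_abs x)
  rw [norm_div, Real.norm_eq_abs, Real.norm_of_nonneg (by positivity), div_le_iff₀ (by positivity),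
    Function.comp_apply, ← div_eq_inv_mul, le_div_iff₀ hx, abs_mul_abs_self, ← sq]
  exact le_add_of_nonneg_left (sq_nonneg τ)

-- `x / (τ² + x²)` has limit zero at both ends of the line and derivative
-- `(τ² - x²) studentFactor τ x`.
lemma integral_sq_mul_studentFactor (hτ : 0 < τ) :
    ∫ x, x ^ 2 * studentFactor τ x = τ ^ 2 * ∫ x, studentFactor τ x := by
  have hderiv : ∀ x : ℝ, HasDerivAt (fun x : ℝ => x / (τ ^ 2 + x ^ 2))
      (τ ^ 2 * studentFactor τ x - x ^ 2 * studentFactor τ x) x := by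
    intro x
    have hne : τ ^ 2 + x ^ 2 ≠ 0 := by positivity
    refine ((hasDerivAt_id' x).div ((hasDerivAt_pow 2 x).const_add (τ ^ 2)) hne).congr_deriv ?_
    rw [studentFactor]
    field_simp
    push_cast
    ring
  have hint₀ := (integrable_studentFactor hτ).const_mul (τ ^ 2)
  have hint₂ := integrable_sq_mul_studentFactor hτ
  have hzero := integral_of_hasDerivAt_of_tendsto hderiv (hint₀.sub hint₂)
    (tendsto_div_sq_add_sq τ tendsto_abs_atBot_atTop)
    (tendsto_div_sq_add_sq τ tendsto_abs_atTop_atTop)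
  rw [integral_sub hint₀ hint₂, integral_const_mul] at hzero
  linarith

lemma integral_vec_prod (f : Fin d → ℝ → ℝ) :
    ∫ θ : Vec d, ∏ i, f i (θ i) = ∏ i, ∫ x, f i x := by
  rw [← integral_fintype_prod_volume_eq_prod,
    ← (PiLp.volume_preserving_toLp (Fin d)).integral_comp
      (MeasurableEquiv.toLp 2 (Fin d → ℝ)).measurableEmbedding]

lemma integrable_vec_prod {f : Fin d → ℝ → ℝ} (hf : ∀ i, Integrable (f i)) :
    Integrable fun θ : Vec d => ∏ i, f i (θ i) := by
  rw [← (PiLp.volume_preserving_toLp (Fin d)).integrable_comp_emb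
      (MeasurableEquiv.toLp 2 (Fin d → ℝ)).measurableEmbedding]
  exact Integrable.fintype_prod hf

lemma integrable_studentWeight (hτ : 0 < τ) : Integrable (studentWeight τ : Vec d → ℝ) :=
  integrable_vec_prod fun _ => integrable_studentFactor hτ

lemma apply_sq_mul_studentWeight_eq_prod (τ : ℝ) (j : Fin d) (θ : Vec d) :
    θ j ^ 2 * studentWeight τ θ =
      ∏ i, Function.update (fun _ => studentFactor τ) j
        (fun x => x ^ 2 * studentFactor τ x) i (θ i) := by
  rw [studentWeight_eq_prod, ← Finset.mul_prod_erase _ _ (Finset.mem_univ j),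
    ← Finset.mul_prod_erase _ _ (Finset.mem_univ j), Function.update_self, ← mul_assoc]
  congr 1
  exact Finset.prod_congr rfl fun i hi => by rw [Function.update_of_ne (Finset.ne_of_mem_erase hi)]

lemma integrable_apply_sq_mul_studentWeight (hτ : 0 < τ) (j : Fin d) :
    Integrable fun θ : Vec d => θ j ^ 2 * studentWeight τ θ := by
  simp only [apply_sq_mul_studentWeight_eq_prod]
  refine integrable_vec_prod fun i => ?_
  rcases eq_or_ne i j with rfl | hij
  · simpa only [Function.update_self] using integrable_sq_mul_studentFactor hτ
  · simpa only [Function.update_of_ne hij] using integrable_studentFactor hτ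

lemma integral_apply_sq_mul_studentWeight (hτ : 0 < τ) (j : Fin d) :
    ∫ θ : Vec d, θ j ^ 2 * studentWeight τ θ = τ ^ 2 * ∫ θ : Vec d, studentWeight τ θ := by
  simp only [apply_sq_mul_studentWeight_eq_prod]
  simp only [studentWeight_eq_prod]
  rw [integral_vec_prod, integral_vec_prod fun _ => studentFactor τ,
    ← Finset.mul_prod_erase _ _ (Finset.mem_univ j),
    ← Finset.mul_prod_erase _ (fun _ => ∫ x, studentFactor τ x) (Finset.mem_univ j), ← mul_assoc,
    Function.update_self, integral_sq_mul_studentFactor hτ]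
  congr 1
  exact Finset.prod_congr rfl fun i hi => by rw [Function.update_of_ne (Finset.ne_of_mem_erase hi)]

lemma integrable_norm_sq_mul_studentWeight (hτ : 0 < τ) :
    Integrable fun θ : Vec d => ‖θ‖ ^ 2 * studentWeight τ θ := by
  simp only [EuclideanSpace.real_norm_sq_eq, Finset.sum_mul]
  exact integrable_finsetSum _ fun j _ => integrable_apply_sq_mul_studentWeight hτ j

lemma integral_norm_sq_mul_studentWeight (hτ : 0 < τ) :
    ∫ θ : Vec d, ‖θ‖ ^ 2 * studentWeight τ θ = d * τ ^ 2 * ∫ θ : Vec d, studentWeight τ θ := by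
  simp only [EuclideanSpace.real_norm_sq_eq, Finset.sum_mul]
  rw [integral_finsetSum _ fun j _ => integrable_apply_sq_mul_studentWeight hτ j]
  simp [integral_apply_sq_mul_studentWeight hτ, mul_assoc]

lemma sq_mul_setIntegral_compl_closedBall_le {E : Type*} [NormedAddCommGroup E]
    [MeasurableSpace E] [OpensMeasurableSpace E] {μ : Measure E} {W : E → ℝ} (hW₀ : ∀ x, 0 ≤ W x)
    (hW : Integrable W μ) (hW₂ : Integrable (fun x => ‖x‖ ^ 2 * W x) μ) {ρ : ℝ} (hρ : 0 ≤ ρ) :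
    ρ ^ 2 * ∫ x in (Metric.closedBall 0 ρ)ᶜ, W x ∂μ ≤ ∫ x, ‖x‖ ^ 2 * W x ∂μ := by
  rw [← integral_const_mul]
  refine le_trans (setIntegral_mono_on (hW.const_mul _).integrableOn hW₂.integrableOn
    Metric.isClosed_closedBall.measurableSet.compl fun x hx => ?_)
    (setIntegral_le_integral hW₂ (.of_forall fun x => mul_nonneg (sq_nonneg _) (hW₀ x)))
  rw [Set.mem_compl_iff, mem_closedBall_zero_iff, not_le] at hx
  exact mul_le_mul_of_nonneg_right (pow_le_pow_left₀ hρ hx.le 2) (hW₀ x)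

lemma mul_integral_studentWeight_le_setIntegral_closedBall (hτ : 0 < τ) {ρ : ℝ} (hρ : 0 < ρ) :
    (1 - d * τ ^ 2 / ρ ^ 2) * ∫ θ : Vec d, studentWeight τ θ ≤
      ∫ θ in Metric.closedBall (0 : Vec d) ρ, studentWeight τ θ := by
  have hW := integrable_studentWeight (d := d) hτ
  have htail := sq_mul_setIntegral_compl_closedBall_le (fun θ => (studentWeight_pos hτ θ).le) hW
    (integrable_norm_sq_mul_studentWeight hτ) hρ.le
  rw [integral_norm_sq_mul_studentWeight hτ, ← le_div_iff₀' (by positivity),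
    mul_div_right_comm] at htail
  have hsplit := integral_add_compl (s := Metric.closedBall (0 : Vec d) ρ)
    Metric.isClosed_closedBall.measurableSet hW
  rw [sub_mul, one_mul]
  linarith

lemma studentFactor_le_mul_studentFactor_add {C t : ℝ} (hτ : 0 < τ) (ht : |t| ≤ C) (x : ℝ) :
    studentFactor τ x ≤ (2 + 2 * (C / τ) ^ 2) ^ 2 * studentFactor τ (x + t) := by
  have hle : τ ^ 2 + (x + t) ^ 2 ≤ (2 + 2 * (C / τ) ^ 2) * (τ ^ 2 + x ^ 2) := by
    have ht₂ : t ^ 2 ≤ C ^ 2 := sq_le_sq' (abs_le.1 ht).1 (abs_le.1 ht).2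
    calc τ ^ 2 + (x + t) ^ 2 ≤ 2 * τ ^ 2 + 2 * x ^ 2 + 2 * C ^ 2 + 2 * (C / τ) ^ 2 * x ^ 2 := by
          nlinarith [sq_nonneg (x - t), mul_nonneg (sq_nonneg (C / τ)) (sq_nonneg x), sq_nonneg τ]
      _ = (2 + 2 * (C / τ) ^ 2) * (τ ^ 2 + x ^ 2) := by field_simp; ring
  rw [studentFactor, studentFactor, ← div_eq_mul_inv, inv_eq_one_div,
    div_le_div_iff₀ (by positivity) (by positivity), one_mul, ← mul_pow]
  gcongr

lemma studentWeight_le_mul_studentWeight_add {C : ℝ} (hτ : 0 < τ) {v : Vec d} (hv : l1 v ≤ C)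
    (θ : Vec d) :
    studentWeight τ θ ≤ (2 + 2 * (C / τ) ^ 2) ^ (2 * l0 v) * studentWeight τ (θ + v) := by
  rw [studentWeight_eq_prod, studentWeight_eq_prod, pow_mul, l0, ← Finset.prod_const,
    Finset.prod_filter, ← Finset.prod_mul_distrib]
  refine Finset.prod_le_prod (fun i _ => (studentFactor_pos hτ _).le) fun i _ => ?_
  split_ifs with hi
  · exact studentFactor_le_mul_studentFactor_add hτ ((abs_le_l1 v i).trans hv) _
  · simp [not_not.1 hi]

lemma mul_integral_studentWeight_le_setIntegral_closedBall_of_l1_le {C ρ : ℝ} (hτ : 0 < τ)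
    (hρ : 0 < ρ) {v : Vec d} (hv : l1 v ≤ C) :
    (1 - d * τ ^ 2 / ρ ^ 2) * ∫ θ : Vec d, studentWeight τ θ ≤
      (2 + 2 * (C / τ) ^ 2) ^ (2 * l0 v) * ∫ θ in Metric.closedBall v ρ, studentWeight τ θ := by
  have hW := integrable_studentWeight (d := d) hτ
  have hpre : (fun θ => θ + v) ⁻¹' Metric.closedBall v ρ = Metric.closedBall 0 ρ := by
    ext θ; simp [dist_eq_norm]
  rw [← (measurePreserving_add_right volume v).setIntegral_preimage_emb
    (measurableEmbedding_addRight v), hpre]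
  calc (1 - d * τ ^ 2 / ρ ^ 2) * ∫ θ : Vec d, studentWeight τ θ
      ≤ ∫ θ in Metric.closedBall 0 ρ, studentWeight τ θ :=
        mul_integral_studentWeight_le_setIntegral_closedBall hτ hρ
    _ ≤ ∫ θ in Metric.closedBall 0 ρ,
          (2 + 2 * (C / τ) ^ 2) ^ (2 * l0 v) * studentWeight τ (θ + v) :=
        setIntegral_mono hW.integrableOn ((hW.comp_add_right v).const_mul _).integrableOn
          (studentWeight_le_mul_studentWeight_add hτ hv)
    _ = _ := integral_const_mul _ _

lemma setIntegral_ballL1_studentWeight_pos (hτ : 0 < τ) (hC₁ : 0 < C₁) :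
    0 < ∫ θ in ballL1 d C₁, studentWeight τ θ := by
  rw [setIntegral_pos_iff_support_of_nonneg_ae (.of_forall fun θ => (studentWeight_pos hτ θ).le)
    (integrable_studentWeight hτ).integrableOn, Function.support_eq_univ fun θ =>
      (studentWeight_pos hτ θ).ne', Set.univ_inter]
  exact Measure.measure_pos_of_mem_nhds _ (ballL1_mem_nhds_zero hC₁)

lemma prior_apply (hτ : 0 < τ) {S : Set (Vec d)} (hS : MeasurableSet S) :
    prior d C₁ τ S = ENNReal.ofReal ((∫ θ in S ∩ ballL1 d C₁, studentWeight τ θ) /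
      ∫ θ in ballL1 d C₁, studentWeight τ θ) := by
  rw [prior, withDensity_apply _ hS, Measure.restrict_restrict hS,
    ← ofReal_integral_eq_lintegral_ofReal
      ((integrable_studentWeight hτ).integrableOn.div_const _), integral_div]
  exact .of_forall fun θ => div_nonneg (studentWeight_pos hτ θ).le
    (integral_nonneg fun t => (studentWeight_pos hτ t).le)

lemma isProbabilityMeasure_prior (hτ : 0 < τ) (hC₁ : 0 < C₁) :
    IsProbabilityMeasure (prior d C₁ τ) := by
  constructor
  rw [prior_apply hτ .univ, Set.univ_inter,
    div_self (setIntegral_ballL1_studentWeight_pos hτ hC₁).ne', ENNReal.ofReal_one]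

lemma ae_prior_mem_ballL1 (C₁ τ : ℝ) : ∀ᵐ θ ∂prior d C₁ τ, θ ∈ ballL1 d C₁ :=
  (withDensity_absolutelyContinuous _ _).ae_le (ae_restrict_mem (measurableSet_ballL1 C₁))

lemma one_sub_le_mul_prior_closedBall {ρ : ℝ} (hτ : 0 < τ) (hC₁ : 0 < C₁) (hρ : 0 < ρ)
    (hdρ : d * τ ^ 2 ≤ ρ ^ 2) {v : Vec d} (hv : l1 v + √d * ρ ≤ C₁) :
    1 - d * τ ^ 2 / ρ ^ 2 ≤ (2 + 2 * (C₁ / τ) ^ 2) ^ (2 * l0 v) *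
      (prior d C₁ τ).real (Metric.closedBall v ρ) := by
  have hZ : 0 < ∫ θ in ballL1 d C₁, studentWeight τ θ := setIntegral_ballL1_studentWeight_pos hτ hC₁
  have hZle : ∫ θ in ballL1 d C₁, studentWeight τ θ ≤ ∫ θ : Vec d, studentWeight τ θ :=
    setIntegral_le_integral (integrable_studentWeight hτ)
      (.of_forall fun θ => (studentWeight_pos hτ θ).le)
  have hv₁ : l1 v ≤ C₁ := (le_add_of_nonneg_right (by positivity)).trans hv
  have hfrac : 0 ≤ 1 - d * τ ^ 2 / ρ ^ 2 := sub_nonneg.2 (div_le_one_of_le₀ hdρ (by positivity))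
  rw [Measure.real, prior_apply hτ Metric.isClosed_closedBall.measurableSet,
    Set.inter_eq_left.2 (closedBall_subset_ballL1 hv), ENNReal.toReal_ofReal
      (div_nonneg (integral_nonneg fun θ => (studentWeight_pos hτ θ).le) hZ.le), ← mul_div_assoc,
    le_div_iff₀ hZ]
  exact (mul_le_mul_of_nonneg_left hZle hfrac).trans
    (mul_integral_studentWeight_le_setIntegral_closedBall_of_l1_le hτ hρ hv₁)

lemma one_le_mul_prior_closedBall (hτ : 0 < τ) (hC₁ : 0 < C₁) (hd : 0 < d) {v : Vec d}
    (hv : l1 v + 2 * d * τ ≤ C₁) {k : ℕ} (hk : l0 v ≤ k) :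
    1 ≤ 4 / 3 * (2 + 2 * (C₁ / τ) ^ 2) ^ (2 * k) *
      (prior d C₁ τ).real (Metric.closedBall v (2 * √d * τ)) := by
  have hd' : (0 : ℝ) < d := Nat.cast_pos.2 hd
  have hdd : √(d : ℝ) ^ 2 = d := Real.sq_sqrt hd'.le
  have hmass := one_sub_le_mul_prior_closedBall hτ hC₁ (ρ := 2 * √d * τ) (by positivity)
    (by nlinarith [mul_pos hd' (sq_pos_of_pos hτ)])
    (v := v) (hv.trans' (le_of_eq (by linear_combination 2 * τ * hdd)))
  have hquarter : (d : ℝ) * τ ^ 2 / (2 * √d * τ) ^ 2 = 1 / 4 := by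
    rw [mul_pow, mul_pow, hdd]; field_simp; norm_num
  have hpow : (2 + 2 * (C₁ / τ) ^ 2) ^ (2 * l0 v) ≤ (2 + 2 * (C₁ / τ) ^ 2) ^ (2 * k) :=
    pow_le_pow_right₀ (by nlinarith [sq_nonneg (C₁ / τ)]) (by lia)
  have hle := mul_le_mul_of_nonneg_right hpow
    (measureReal_nonneg (μ := prior d C₁ τ) (s := Metric.closedBall v (2 * √d * τ)))
  linarith

end StudentPrior

section GibbsMeasures

lemma integral_le_add_mul_measureReal_compl {α : Type*} [MeasurableSpace α] {ρ : Measure α}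
    [IsProbabilityMeasure ρ] {f : α → ℝ} {b M : ℝ} {s : Set α} (hs : MeasurableSet s)
    (hf : ∀ x, 0 ≤ f x) (hb : 0 ≤ b) (hfs : ∀ x ∈ s, f x ≤ b) (hfM : ∀ᵐ x ∂ρ, f x ≤ M) :
    ∫ x, f x ∂ρ ≤ b + M * ρ.real sᶜ := by
  have hind : Integrable (sᶜ.indicator (1 : α → ℝ)) ρ := (integrable_const 1).indicator hs.compl
  calc ∫ x, f x ∂ρ ≤ ∫ x, (b + M * sᶜ.indicator 1 x) ∂ρ := by
        refine integral_mono_of_nonneg (.of_forall hf)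
          ((integrable_const b).add (hind.const_mul M)) ?_
        filter_upwards [hfM] with x hx
        by_cases h : x ∈ s
        · simpa [h] using hfs x h
        · simpa [h] using hx.trans (le_add_of_nonneg_left hb)
    _ = b + M * ρ.real sᶜ := by
      rw [integral_add (integrable_const b) (hind.const_mul M), integral_const_mul,
        integral_indicator_one hs.compl]
      simp

lemma norm_integral_id_sub_le {E : Type*} [NormedAddCommGroup E] [NormedSpace ℝ E]
    [MeasurableSpace E] [BorelSpace E] [SecondCountableTopology E] [CompleteSpace E]
    {ρ : Measure E} [IsProbabilityMeasure ρ] {x₀ : E} {r M : ℝ} (hr : 0 ≤ r)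
    (hM : ∀ᵐ x ∂ρ, ‖x - x₀‖ ≤ M) :
    ‖(∫ x, x ∂ρ) - x₀‖ ≤ r + M * ρ.real (Metric.ball x₀ r)ᶜ := by
  have hint : Integrable (fun x => x - x₀) ρ :=
    Integrable.of_bound (by fun_prop) M hM
  have hid : Integrable (fun x : E => x) ρ :=
    (hint.add (integrable_const x₀)).congr (.of_forall fun x => sub_add_cancel x x₀)
  calc ‖(∫ x, x ∂ρ) - x₀‖ = ‖∫ x, (x - x₀) ∂ρ‖ := by
        rw [integral_sub hid (integrable_const _)]; simp
    _ ≤ ∫ x, ‖x - x₀‖ ∂ρ := norm_integral_le_integral_norm _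
    _ ≤ r + M * ρ.real (Metric.ball x₀ r)ᶜ :=
      integral_le_add_mul_measureReal_compl Metric.isOpen_ball.measurableSet
        (fun _ => norm_nonneg _) hr (fun x hx => (mem_ball_iff_norm.1 hx).le) hM

section Laplace

variable {Z : Type*} [MeasurableSpace Z] {P : Measure Z} [IsProbabilityMeasure P] {T : Z → ℝ}
  {B u : ℝ}

lemma integral_exp_neg_mul_le (hT : AEStronglyMeasurable T P) (hB : ∀ᵐ z ∂P, |T z| ≤ B)
    (hu : 0 ≤ u) (huB : u * B ≤ 1) (hvar : u * ∫ z, T z ^ 2 ∂P ≤ (∫ z, T z ∂P) / 2) :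
    ∫ z, Real.exp (-(u * T z)) ∂P ≤ Real.exp (-(u * ((∫ z, T z ∂P) / 2))) := by
  have hint : Integrable T P := Integrable.of_bound hT B hB
  have hint₂ : Integrable (fun z => T z ^ 2) P := by
    refine Integrable.of_bound (hT.pow 2) (B ^ 2) ?_
    filter_upwards [hB] with z hz
    rw [Real.norm_eq_abs, abs_pow]
    exact pow_le_pow_left₀ (abs_nonneg _) hz 2
  have hsum : Integrable (fun z => 1 + u ^ 2 * T z ^ 2) P :=
    (integrable_const 1).add (hint₂.const_mul _)
  calc ∫ z, Real.exp (-(u * T z)) ∂P ≤ ∫ z, (1 + u ^ 2 * T z ^ 2 - u * T z) ∂P := by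
        refine integral_mono_of_nonneg (.of_forall fun z => (Real.exp_pos _).le)
          (hsum.sub (hint.const_mul u)) ?_
        filter_upwards [hB] with z hz
        have habs : |-(u * T z)| ≤ 1 := by
          rw [abs_neg, abs_mul, abs_of_nonneg hu]
          exact (mul_le_mul_of_nonneg_left hz hu).trans huB
        have := (abs_le.1 (Real.abs_exp_sub_one_sub_id_le habs)).2
        linarith
    _ = 1 + u * (u * ∫ z, T z ^ 2 ∂P) - u * ∫ z, T z ∂P := by
        rw [integral_sub hsum (hint.const_mul u),
          integral_add (integrable_const 1) (hint₂.const_mul _), integral_const_mul,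
          integral_const_mul]
        simp only [integral_const, probReal_univ, one_smul]
        ring
    _ ≤ 1 + u * ((∫ z, T z ∂P) / 2) - u * ∫ z, T z ∂P := by gcongr
    _ = -(u * ((∫ z, T z ∂P) / 2)) + 1 := by ring
    _ ≤ Real.exp (-(u * ((∫ z, T z ∂P) / 2))) := Real.add_one_le_exp _

lemma integral_pi_exp_neg_mul_sum_le {ι : Type*} [Fintype ι] (hT : AEStronglyMeasurable T P)
    (hB : ∀ᵐ z ∂P, |T z| ≤ B) (hu : 0 ≤ u) (huB : u * B ≤ 1)
    (hvar : u * ∫ z, T z ^ 2 ∂P ≤ (∫ z, T z ∂P) / 2) :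
    ∫ D, Real.exp (-(u * ∑ i, T (D i))) ∂Measure.pi (fun _ : ι => P) ≤
      Real.exp (-(Fintype.card ι * u * ((∫ z, T z ∂P) / 2))) := by
  calc ∫ D, Real.exp (-(u * ∑ i, T (D i))) ∂Measure.pi (fun _ : ι => P)
      = (∫ z, Real.exp (-(u * T z)) ∂P) ^ Fintype.card ι := by
        rw [← integral_fintype_prod_eq_pow]
        simp only [← Real.exp_sum, Finset.sum_neg_distrib, Finset.mul_sum]
    _ ≤ Real.exp (-(u * ((∫ z, T z ∂P) / 2))) ^ Fintype.card ι :=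
        pow_le_pow_left₀ (integral_nonneg fun z => (Real.exp_pos _).le)
          (integral_exp_neg_mul_le hT hB hu huB hvar) _
    _ = Real.exp (-(Fintype.card ι * u * ((∫ z, T z ∂P) / 2))) := by
        rw [← Real.exp_nat_mul]; congr 1; ring

end Laplace

section Tilted

variable {E : Type*} [MeasurableSpace E] {π : Measure E} {g : E → ℝ}

lemma tilted_add_const (π : Measure E) (g : E → ℝ) (c : ℝ) :
    (π.tilted fun θ => g θ + c) = π.tilted g := by
  simp only [Measure.tilted, Real.exp_add, integral_mul_const,
    mul_div_mul_right _ _ (Real.exp_pos c).ne']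

lemma tilted_real_eq_div (π : Measure E) [SFinite π] (g : E → ℝ) (S : Set E) :
    (π.tilted g).real S = (∫ θ in S, Real.exp (g θ) ∂π) / ∫ θ, Real.exp (g θ) ∂π := by
  rw [Measure.real, tilted_apply_eq_ofReal_integral, integral_div, ENNReal.toReal_ofReal
    (div_nonneg (integral_nonneg fun _ => (Real.exp_pos _).le)
      (integral_nonneg fun _ => (Real.exp_pos _).le))]

lemma tilted_real_le [IsFiniteMeasure π] (hg : Integrable (fun θ => Real.exp (g θ)) π)
    {A S : Set E} (hA : MeasurableSet A) {c m : ℝ} (hm : 1 ≤ m * π.real A)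
    (hcA : ∀ θ ∈ A, c ≤ g θ) :
    (π.tilted g).real S ≤ m * Real.exp (-c) * ∫ θ in S, Real.exp (g θ) ∂π := by
  have hm₀ : 0 < m := pos_of_mul_pos_left (zero_lt_one.trans_le hm) measureReal_nonneg
  have hZ : Real.exp c * π.real A ≤ ∫ θ, Real.exp (g θ) ∂π :=
    (setIntegral_ge_of_const_le_real hA (measure_ne_top _ _)
      (fun θ hθ => Real.exp_le_exp.2 (hcA θ hθ)) hg.integrableOn).trans
      (setIntegral_le_integral hg (.of_forall fun θ => (Real.exp_pos _).le))
  have hone : 1 ≤ m * Real.exp (-c) * ∫ θ, Real.exp (g θ) ∂π :=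
    calc 1 ≤ m * π.real A := hm
      _ = m * Real.exp (-c) * (Real.exp c * π.real A) := by
        rw [Real.exp_neg]; field_simp
      _ ≤ _ := by gcongr
  have hZ₀ : 0 < ∫ θ, Real.exp (g θ) ∂π :=
    pos_of_mul_pos_right (zero_lt_one.trans_le hone) (by positivity)
  rw [tilted_real_eq_div, div_le_iff₀ hZ₀, mul_right_comm]
  exact le_mul_of_one_le_left (integral_nonneg fun _ => (Real.exp_pos _).le) hone

lemma measurable_tilted_real {Ω : Type*} [MeasurableSpace Ω] [SFinite π] {g : Ω × E → ℝ}
    (hg : Measurable g) (S : Set E) :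
    Measurable fun D => (π.tilted fun θ => g (D, θ)).real S := by
  simp only [tilted_real_eq_div]
  exact (hg.exp.stronglyMeasurable.integral_prod_right.measurable).div
    hg.exp.stronglyMeasurable.integral_prod_right.measurable

end Tilted

lemma integral_setIntegral_le {α β : Type*} [MeasurableSpace α] [MeasurableSpace β]
    {μ : Measure α} {ν : Measure β} [SFinite μ] [IsProbabilityMeasure ν] {f : α × β → ℝ}
    {S : Set β} (hf : Integrable f (μ.prod (ν.restrict S))) (hS : MeasurableSet S) {κ : ℝ}
    (hκ₀ : 0 ≤ κ) (hκ : ∀ b ∈ S, ∫ a, f (a, b) ∂μ ≤ κ) :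
    ∫ a, ∫ b in S, f (a, b) ∂ν ∂μ ≤ κ := by
  rw [integral_integral_swap (f := fun a b => f (a, b)) hf]
  calc ∫ b in S, ∫ a, f (a, b) ∂μ ∂ν ≤ ∫ _ in S, κ ∂ν :=
        setIntegral_mono_on hf.integral_prod_right (integrable_const _).integrableOn hS hκ
    _ ≤ κ := by
        rw [setIntegral_const, smul_eq_mul]
        exact mul_le_of_le_one_left hκ₀ measureReal_le_one

lemma ae_pi_forall {ι Z : Type*} [Fintype ι] [MeasurableSpace Z] {P : Measure Z} [SigmaFinite P]
    {p : Z → Prop} (h : ∀ᵐ z ∂P, p z) : ∀ᵐ D ∂Measure.pi (fun _ : ι => P), ∀ i, p (D i) :=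
  ae_all_iff.2 fun i => (Measure.quasiMeasurePreserving_eval (fun _ => P) i).ae h

section Concentration

variable {ι E Z : Type*} [Fintype ι] [MeasurableSpace E] [MeasurableSpace Z] {P : Measure Z}
  [IsProbabilityMeasure P] {π : Measure E} [IsProbabilityMeasure π] {T : E → Z → ℝ} {Θ : Set E}
  {B u : ℝ}

lemma measurable_neg_mul_sum (hT : Measurable (Function.uncurry T)) (u : ℝ) :
    Measurable fun q : (ι → Z) × E => -(u * ∑ i, T q.2 (q.1 i)) := by
  have : ∀ i, Measurable fun q : (ι → Z) × E => T q.2 (q.1 i) := fun i =>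
    hT.comp (measurable_snd.prodMk ((measurable_pi_apply i).comp measurable_fst))
  fun_prop

lemma integrable_exp_neg_mul_sum (hT : Measurable (Function.uncurry T))
    (hΘ : ∀ᵐ θ ∂π, θ ∈ Θ) (hB : ∀ᵐ z ∂P, ∀ θ ∈ Θ, |T θ z| ≤ B) (hu : 0 ≤ u) :
    Integrable (fun q : (ι → Z) × E => Real.exp (-(u * ∑ i, T q.2 (q.1 i))))
      ((Measure.pi fun _ : ι => P).prod π) := by
  refine Integrable.of_bound (measurable_neg_mul_sum hT u).exp.aestronglyMeasurable
    (Real.exp (u * ∑ _ : ι, B)) ?_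
  filter_upwards [Measure.quasiMeasurePreserving_fst.ae (ae_pi_forall hB),
    Measure.quasiMeasurePreserving_snd.ae hΘ] with q hq hqΘ
  rw [Real.norm_of_nonneg (Real.exp_pos _).le, Real.exp_le_exp, ← mul_neg,
    ← Finset.sum_neg_distrib]
  gcongr with i
  exact neg_le.1 (abs_le.1 (hq i q.2 hqΘ)).1

lemma ae_tilted_neg_mul_sum_real_le (hT : Measurable (Function.uncurry T))
    (hΘ : ∀ᵐ θ ∂π, θ ∈ Θ) (hB : ∀ᵐ z ∂P, ∀ θ ∈ Θ, |T θ z| ≤ B) (hu : 0 ≤ u) {A : Set E}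
    (hA : MeasurableSet A) {m δ : ℝ} (hm : 1 ≤ m * π.real A)
    (hδ : ∀ᵐ z ∂P, ∀ θ ∈ A, T θ z ≤ δ) (S : Set E) :
    ∀ᵐ D ∂Measure.pi (fun _ : ι => P), (π.tilted fun θ => -(u * ∑ i, T θ (D i))).real S ≤
      m * Real.exp (Fintype.card ι * u * δ) *
        ∫ θ in S, Real.exp (-(u * ∑ i, T θ (D i))) ∂π := by
  filter_upwards [ae_pi_forall hδ, (integrable_exp_neg_mul_sum hT hΘ hB hu).prod_right_ae]
    with D hD hint
  rw [← neg_neg (Fintype.card ι * u * δ)]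
  refine tilted_real_le hint hA hm fun θ hθ => neg_le_neg ?_
  calc u * ∑ i, T θ (D i) ≤ u * ∑ _ : ι, δ := by gcongr with i; exact hD i θ hθ
    _ = Fintype.card ι * u * δ := by simp; ring

lemma integral_tilted_neg_mul_sum_real_le (hT : Measurable (Function.uncurry T))
    (hΘ : ∀ᵐ θ ∂π, θ ∈ Θ) (hB : ∀ᵐ z ∂P, ∀ θ ∈ Θ, |T θ z| ≤ B) (hu : 0 ≤ u) (huB : u * B ≤ 1)
    (hvar : ∀ θ ∈ Θ, u * ∫ z, T θ z ^ 2 ∂P ≤ (∫ z, T θ z ∂P) / 2) {A S : Set E}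
    (hA : MeasurableSet A) {m δ κ : ℝ} (hm : 1 ≤ m * π.real A)
    (hδ : ∀ᵐ z ∂P, ∀ θ ∈ A, T θ z ≤ δ) (hS : MeasurableSet S) (hSΘ : S ⊆ Θ)
    (hκ : ∀ θ ∈ S, κ ≤ ∫ z, T θ z ∂P) :
    ∫ D, (π.tilted fun θ => -(u * ∑ i, T θ (D i))).real S ∂Measure.pi (fun _ : ι => P) ≤
      m * Real.exp (Fintype.card ι * u * (δ - κ / 2)) := by
  have hm₀ : 0 < m := pos_of_mul_pos_left (zero_lt_one.trans_le hm) measureReal_nonneg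
  have hint := (integrable_exp_neg_mul_sum (ι := ι) hT hΘ hB hu).mono_measure
    (Measure.prod_mono le_rfl (Measure.restrict_le_self (s := S)))
  calc _ ≤ ∫ D, m * Real.exp (Fintype.card ι * u * δ) *
          ∫ θ in S, Real.exp (-(u * ∑ i, T θ (D i))) ∂π ∂Measure.pi (fun _ : ι => P) :=
        integral_mono_of_nonneg (.of_forall fun D => measureReal_nonneg)
          (hint.integral_prod_left.const_mul _)
          (ae_tilted_neg_mul_sum_real_le hT hΘ hB hu hA hm hδ S)
    _ ≤ m * Real.exp (Fintype.card ι * u * δ) *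
          Real.exp (-(Fintype.card ι * u * (κ / 2))) := by
        rw [integral_const_mul]
        gcongr
        refine integral_setIntegral_le hint hS (Real.exp_pos _).le fun θ hθ => ?_
        have hBθ : ∀ᵐ z ∂P, |T θ z| ≤ B := hB.mono fun z hz => hz θ (hSΘ hθ)
        refine (integral_pi_exp_neg_mul_sum_le hT.of_uncurry_left.aestronglyMeasurable hBθ hu huB
          (hvar θ (hSΘ hθ))).trans ?_
        gcongr
        exact hκ θ hθ
    _ = m * Real.exp (Fintype.card ι * u * (δ - κ / 2)) := by
        rw [mul_assoc, ← Real.exp_add]; congr 2; ring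

end Concentration

end GibbsMeasures

section HingePosterior

variable {d n : ℕ}

/-- The hinge loss of `θ` minus that of the target `θs` at a single observation. -/
def excessLoss (θs θ : Vec d) (z : Obs d) : ℝ :=
  hinge z.2 (inner ℝ θ z.1) - hinge z.2 (inner ℝ θs z.1)

/-- The conditions on a law `P` and a target `θs` under which the posterior is studied: labels of
modulus one, an ideal target in the `ℓ¹` ball, a bounded and Lipschitz loss on that ball, and the
Bernstein condition. -/
structure HingeConditions (P : Measure (Obs d)) (θs : Vec d) (L K B C₁ : ℝ) : Prop where
  abs_label : ∀ᵐ z ∂P, |z.2| = 1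
  target_mem : θs ∈ ballL1 d C₁
  isHingeBayes : IsHingeBayes P θs
  hinge_le : ∀ᵐ z ∂P, ∀ θ ∈ ballL1 d C₁, hinge z.2 (inner ℝ θ z.1) ≤ B
  lipschitz : ∀ᵐ z ∂P, ∀ θ ∈ ballL1 d C₁, ∀ θ' ∈ ballL1 d C₁,
    |hinge z.2 (inner ℝ θ z.1) - hinge z.2 (inner ℝ θ' z.1)| ≤ L * ‖θ - θ'‖
  bernstein : ∀ θ ∈ ballL1 d C₁, ‖θ - θs‖ ^ 2 ≤ K * (hingeRisk P θ - hingeRisk P θs)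

lemma measurable_excessLoss (θs : Vec d) : Measurable (Function.uncurry (excessLoss θs)) :=
  continuous_hinge_inner.measurable.sub
    (continuous_hinge_inner.comp (continuous_const.prodMk continuous_snd)).measurable

lemma gibbs_eq_tilted_excessLoss (hn : n ≠ 0) (C₁ τ w : ℝ) (D : Fin n → Obs d) (θs : Vec d) :
    gibbs C₁ τ (n / w) D =
      (prior d C₁ τ).tilted fun θ => -(w⁻¹ * ∑ i, excessLoss θs θ (D i)) := by
  rw [gibbs, ← tilted_add_const _ (fun θ => -(w⁻¹ * ∑ i, excessLoss θs θ (D i)))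
    (-(w⁻¹ * ∑ i, hinge (D i).2 (inner ℝ θs (D i).1)))]
  congr with θ
  simp only [excessLoss, Finset.sum_sub_distrib, empHingeRisk]
  field_simp
  ring

lemma isProbabilityMeasure_gibbs {C₁ τ lam : ℝ} (hτ : 0 < τ) (hC₁ : 0 < C₁) (hlam : 0 ≤ lam)
    (D : Fin n → Obs d) : IsProbabilityMeasure (gibbs C₁ τ lam D) := by
  have := isProbabilityMeasure_prior (d := d) hτ hC₁
  have hcont : Continuous fun θ : Vec d => empHingeRisk D θ := by
    unfold empHingeRisk hinge; fun_prop
  refine isProbabilityMeasure_tilted (Integrable.of_bound (C := 1) (by fun_prop)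
    (.of_forall fun θ => ?_))
  have hrisk : 0 ≤ empHingeRisk D θ :=
    mul_nonneg (by positivity) (Finset.sum_nonneg fun _ _ => hinge_nonneg _ _)
  rw [Real.norm_of_nonneg (Real.exp_pos _).le, Real.exp_le_one_iff, neg_mul]
  exact neg_nonpos.2 (mul_nonneg hlam hrisk)

lemma ae_gibbs_mem_ballL1 (C₁ τ lam : ℝ) (D : Fin n → Obs d) :
    ∀ᵐ θ ∂gibbs C₁ τ lam D, θ ∈ ballL1 d C₁ :=
  (tilted_absolutelyContinuous _ _).ae_le (ae_prior_mem_ballL1 C₁ τ)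

instance (P : Measure (Obs d)) [IsProbabilityMeasure P] (n : ℕ) :
    IsProbabilityMeasure (sampleLaw P n) :=
  inferInstanceAs (IsProbabilityMeasure (Measure.pi fun _ : Fin n => P))

instance (C₁ τ lam : ℝ) (D : Fin n → Obs d) : IsZeroOrProbabilityMeasure (gibbs C₁ τ lam D) :=
  inferInstanceAs (IsZeroOrProbabilityMeasure (Measure.tilted _ _))

lemma integrable_gibbs_real {C₁ τ : ℝ} (hτ : 0 < τ) (hC₁ : 0 < C₁) (lam : ℝ) (S : Set (Vec d))
    (P : Measure (Obs d)) [IsProbabilityMeasure P] :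
    Integrable (fun D : Fin n → Obs d => (gibbs C₁ τ lam D).real S) (sampleLaw P n) := by
  have := isProbabilityMeasure_prior (d := d) hτ hC₁
  have hcont : Continuous fun q : (Fin n → Obs d) × Vec d => -lam * empHingeRisk q.1 q.2 := by
    unfold empHingeRisk hinge; fun_prop
  refine Integrable.of_bound (measurable_tilted_real hcont.measurable S).aestronglyMeasurable 1
    (.of_forall fun D => ?_)
  rw [Real.norm_of_nonneg measureReal_nonneg]
  exact measureReal_le_one (μ := gibbs C₁ τ lam D)

namespace HingeConditions

variable {P : Measure (Obs d)} {θs θ : Vec d} {L K B C₁ : ℝ}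

lemma ae_norm_le (h : HingeConditions P θs L K B C₁) (hL : 0 ≤ L) (hC₁ : 0 < C₁) :
    ∀ᵐ z ∂P, ‖z.1‖ ≤ L := by
  filter_upwards [h.abs_label, h.lipschitz] with z hz hlip
  refine norm_le_of_eventually_hinge_lipschitz hz hL ?_
  filter_upwards [ballL1_mem_nhds_zero hC₁] with θ hθ
  exact hlip θ hθ 0 (mem_of_mem_nhds (ballL1_mem_nhds_zero hC₁))

lemma ae_abs_excessLoss_le (h : HingeConditions P θs L K B C₁) :
    ∀ᵐ z ∂P, ∀ θ ∈ ballL1 d C₁, |excessLoss θs θ z| ≤ B := by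
  filter_upwards [h.hinge_le] with z hz θ hθ
  exact abs_sub_le_of_nonneg_of_le (hinge_nonneg _ _) (hz θ hθ) (hinge_nonneg _ _)
    (hz θs h.target_mem)

variable [IsProbabilityMeasure P]

lemma integrable_hinge (h : HingeConditions P θs L K B C₁) (hθ : θ ∈ ballL1 d C₁) :
    Integrable (fun z : Obs d => hinge z.2 (inner ℝ θ z.1)) P := by
  refine Integrable.of_bound
    (continuous_hinge_inner.comp (Continuous.prodMk_right θ)).aestronglyMeasurable B ?_
  filter_upwards [h.hinge_le] with z hz
  rw [Real.norm_of_nonneg (hinge_nonneg _ _)]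
  exact hz θ hθ

lemma integral_excessLoss (h : HingeConditions P θs L K B C₁) (hθ : θ ∈ ballL1 d C₁) :
    ∫ z, excessLoss θs θ z ∂P = hingeRisk P θ - hingeRisk P θs :=
  integral_sub (h.integrable_hinge hθ) (h.integrable_hinge h.target_mem)

lemma integral_excessLoss_sq_le (h : HingeConditions P θs L K B C₁) (hθ : θ ∈ ballL1 d C₁) :
    ∫ z, excessLoss θs θ z ^ 2 ∂P ≤ L ^ 2 * K * ∫ z, excessLoss θs θ z ∂P := by
  calc ∫ z, excessLoss θs θ z ^ 2 ∂P ≤ ∫ _, (L * ‖θ - θs‖) ^ 2 ∂P := by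
        refine integral_mono_of_nonneg (.of_forall fun z => sq_nonneg _) (integrable_const _) ?_
        filter_upwards [h.lipschitz] with z hz
        rw [← sq_abs]
        exact pow_le_pow_left₀ (abs_nonneg _) (hz θ hθ θs h.target_mem) 2
    _ = L ^ 2 * ‖θ - θs‖ ^ 2 := by simp [mul_pow]
    _ ≤ L ^ 2 * (K * ∫ z, excessLoss θs θ z ∂P) := by
        rw [h.integral_excessLoss hθ]
        gcongr
        exact h.bernstein θ hθ
    _ = L ^ 2 * K * ∫ z, excessLoss θs θ z ∂P := by ring

lemma inv_mul_integral_excessLoss_sq_le (h : HingeConditions P θs L K B C₁) (hK : 0 < K) {w : ℝ}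
    (hw : 0 < w) (hKw : 2 * L ^ 2 * K ≤ w) (hθ : θ ∈ ballL1 d C₁) :
    w⁻¹ * ∫ z, excessLoss θs θ z ^ 2 ∂P ≤ (∫ z, excessLoss θs θ z ∂P) / 2 := by
  have hrisk : 0 ≤ ∫ z, excessLoss θs θ z ∂P := by
    rw [h.integral_excessLoss hθ]
    exact nonneg_of_mul_nonneg_right ((sq_nonneg _).trans (h.bernstein θ hθ)) hK
  rw [inv_mul_le_iff₀ hw]
  linarith [h.integral_excessLoss_sq_le hθ, mul_le_mul_of_nonneg_right hKw hrisk]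

lemma integral_gibbs_real_compl_ball_le (h : HingeConditions P θs L K B C₁) (hL : 0 ≤ L)
    (hK : 0 < K) (hC₁ : 0 < C₁) {τ w r ε m : ℝ} (hτ : 0 < τ) (hw : 0 < w) (hBw : B ≤ w)
    (hKw : 2 * L ^ 2 * K ≤ w) (hn : n ≠ 0) (hr : 0 ≤ r) {A : Set (Vec d)} (hA : MeasurableSet A)
    (hAC : A ⊆ ballL1 d C₁) (hAε : ∀ θ ∈ A, ‖θ - θs‖ ≤ ε) (hm : 1 ≤ m * (prior d C₁ τ).real A) :
    ∫ D, (gibbs C₁ τ (n / w) D).real (Metric.ball θs r)ᶜ ∂sampleLaw P n ≤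
      m * Real.exp (n / w * (L * ε - r ^ 2 / (2 * K))) := by
  have := isProbabilityMeasure_prior (d := d) hτ hC₁
  have hnear : ∀ᵐ z ∂P, ∀ θ ∈ A, excessLoss θs θ z ≤ L * ε := by
    filter_upwards [h.lipschitz] with z hz θ hθ
    exact (le_abs_self _).trans ((hz θ (hAC hθ) θs h.target_mem).trans (by gcongr; exact hAε θ hθ))
  have hfar : ∀ θ ∈ (Metric.ball θs r)ᶜ ∩ ballL1 d C₁,
      r ^ 2 / K ≤ ∫ z, excessLoss θs θ z ∂P := by
    rintro θ ⟨hθr, hθ⟩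
    rw [Set.mem_compl_iff, mem_ball_iff_norm, not_lt] at hθr
    rw [h.integral_excessLoss hθ, div_le_iff₀' hK]
    exact (pow_le_pow_left₀ hr hθr 2).trans (h.bernstein θ hθ)
  have hrestrict : ∀ D : Fin n → Obs d, (gibbs C₁ τ (n / w) D).real (Metric.ball θs r)ᶜ =
      ((prior d C₁ τ).tilted fun θ => -(w⁻¹ * ∑ i, excessLoss θs θ (D i))).real
        ((Metric.ball θs r)ᶜ ∩ ballL1 d C₁) := by
    intro D
    rw [← gibbs_eq_tilted_excessLoss hn]
    refine measureReal_congr ?_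
    filter_upwards [ae_gibbs_mem_ballL1 C₁ τ (n / w) D] with θ hθ
    exact propext (and_iff_left hθ).symm
  have hconc := integral_tilted_neg_mul_sum_real_le (ι := Fin n) (measurable_excessLoss θs)
    (ae_prior_mem_ballL1 C₁ τ) h.ae_abs_excessLoss_le (inv_nonneg.2 hw.le)
    ((inv_mul_le_one₀ hw).2 hBw)
    (fun θ hθ => h.inv_mul_integral_excessLoss_sq_le hK hw hKw hθ) hA hm hnear
    (Metric.isOpen_ball.measurableSet.compl.inter (measurableSet_ballL1 C₁))
    Set.inter_subset_right hfar
  rw [Fintype.card_fin, div_div, mul_comm K 2, ← div_eq_mul_inv] at hconc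
  exact (integral_congr_ae (.of_forall hrestrict)).trans_le hconc

end HingeConditions

end HingePosterior

section ScaleAndRate

/-- The scales `τ` to which the rate applies, namely those between `1 / (Cx * n * d)` and
`1 / (Cx * n * √d)` for which a ball of `ℓ¹` radius `2 * d * τ` around `θs` fits into the `ℓ¹` ball
of radius `C₁`, possibly after moving its centre by `O(1 / n)`. -/
structure IsAdmissibleScale {d : ℕ} (n : ℕ) (C₁ Cx τ : ℝ) (θs : Vec d) : Prop where
  le_scale : 1 / (Cx * n * d) ≤ τ
  scale_le : τ ≤ 1 / (Cx * n * √d)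
  two_mul_lt : 2 * d * τ < C₁
  l1_le_or_scale_le : l1 θs ≤ C₁ - 2 * d * τ ∨ τ ≤ 1 / (Cx * n * d)

namespace IsAdmissibleScale

variable {d n : ℕ} {C₁ Cx τ ε : ℝ} {θs : Vec d}

lemma of_eq_or_eq (hCx : 0 < Cx) (hn : 0 < n) (hd : 0 < d) (hdτ : 2 * d * τ < C₁)
    (hτ : (τ = 1 / (Cx * n * √d) ∧ l1 θs ≤ C₁ - 2 * d * τ) ∨ τ = 1 / (Cx * n * d)) :
    IsAdmissibleScale n C₁ Cx τ θs := by
  have hsqrt : √(d : ℝ) ≤ d := Real.sqrt_le_self_iff.2 (.inr (Nat.one_le_cast.2 hd))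
  have hle : 1 / (Cx * n * d) ≤ 1 / (Cx * n * √d) := by gcongr
  rcases hτ with ⟨rfl, hl1⟩ | rfl
  · exact ⟨hle, le_rfl, hdτ, .inl hl1⟩
  · exact ⟨le_rfl, hle, hdτ, .inr le_rfl⟩

lemma pos (h : IsAdmissibleScale n C₁ Cx τ θs) (hCx : 0 < Cx) (hn : 0 < n) (hd : 0 < d) :
    0 < τ :=
  lt_of_lt_of_le (by positivity) h.le_scale

lemma two_sqrt_mul_le (h : IsAdmissibleScale n C₁ Cx τ θs) (hd : 0 < d) :
    2 * √d * τ ≤ 2 / (Cx * n) := by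
  calc 2 * √d * τ ≤ 2 * √d * (1 / (Cx * n * √d)) := by gcongr; exact h.scale_le
    _ = 2 / (Cx * n) := by field_simp

lemma l1_le_or_two_mul_le (h : IsAdmissibleScale n C₁ Cx τ θs) (hd : 0 < d) :
    l1 θs ≤ C₁ - 2 * d * τ ∨ 2 * d * τ ≤ 2 / (Cx * n) := by
  refine h.l1_le_or_scale_le.imp_right fun hτ => ?_
  calc 2 * d * τ ≤ 2 * d * (1 / (Cx * n * d)) := by gcongr
    _ = 2 / (Cx * n) := by field_simp

lemma two_add_sq_le (h : IsAdmissibleScale n C₁ Cx τ θs) (hC₁ : 0 ≤ C₁) (hCx : 0 < Cx)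
    (hn : 0 < n) (hd : 0 < d) :
    2 + 2 * (C₁ / τ) ^ 2 ≤ (2 + 2 * (C₁ * Cx) ^ 2) * (n * d) ^ 2 := by
  have hone : (1 : ℝ) ≤ (n * d) ^ 2 :=
    one_le_pow₀ (one_le_mul_of_one_le_of_one_le (Nat.one_le_cast.2 hn) (Nat.one_le_cast.2 hd))
  have hdiv : C₁ / τ ≤ C₁ * Cx * (n * d) := by
    calc C₁ / τ ≤ C₁ / (1 / (Cx * n * d)) := by gcongr; exact h.le_scale
      _ = C₁ * Cx * (n * d) := by field_simp
  calc 2 + 2 * (C₁ / τ) ^ 2 ≤ 2 * (n * d) ^ 2 + 2 * (C₁ * Cx * (n * d)) ^ 2 := by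
        have := h.pos hCx hn hd
        gcongr
        linarith
    _ = (2 + 2 * (C₁ * Cx) ^ 2) * (n * d) ^ 2 := by ring

lemma exists_one_le_mul_prior (h : IsAdmissibleScale n C₁ Cx τ θs) (hC₁ : 0 < C₁) (hCx : 0 < Cx)
    (hn : 0 < n) (hd : 0 < d) (hθs : θs ∈ ballL1 d C₁) (hε : 0 < ε) :
    ∃ A, MeasurableSet A ∧ A ⊆ ballL1 d C₁ ∧ (∀ θ ∈ A, ‖θ - θs‖ ≤ ε + 4 / (Cx * n)) ∧
      1 ≤ 4 / 3 * ((2 + 2 * (C₁ * Cx) ^ 2) * (n * d) ^ 2) ^ (2 * ⌊(C₁ / ε) ^ 2⌋₊) *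
        (prior d C₁ τ).real A := by
  have hτ := h.pos hCx hn hd
  obtain ⟨v, hv, hv₀, hvθ⟩ := exists_sparse_l1_add_le hε (by positivity) h.two_mul_lt hθs
    (h.l1_le_or_two_mul_le hd) (by positivity)
  have hsqrt : l1 v + √d * (2 * √d * τ) ≤ C₁ := by
    rwa [← mul_assoc, mul_left_comm, Real.mul_self_sqrt d.cast_nonneg]
  refine ⟨Metric.closedBall v (2 * √d * τ), Metric.isClosed_closedBall.measurableSet,
    closedBall_subset_ballL1 hsqrt, fun θ hθ => ?_, ?_⟩
  · calc ‖θ - θs‖ ≤ ‖θ - v‖ + ‖v - θs‖ := norm_sub_le_norm_sub_add_norm_sub _ _ _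
      _ ≤ 2 / (Cx * n) + (ε + 2 / (Cx * n)) :=
        add_le_add ((mem_closedBall_iff_norm.1 hθ).trans (h.two_sqrt_mul_le hd)) hvθ
      _ = ε + 4 / (Cx * n) := by ring
  · refine (one_le_mul_prior_closedBall hτ hC₁ hd hv hv₀).trans ?_
    gcongr
    exact h.two_add_sq_le hC₁.le hCx hn hd

end IsAdmissibleScale

lemma pow_mul_exp_neg_mul_le {a t : ℝ} (ha : 0 < a) (ht : 0 ≤ t) (k : ℕ) :
    t ^ k * Real.exp (-(a * t)) ≤ k.factorial / a ^ k := by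
  have hexp := Real.pow_div_factorial_le_exp (a * t) (by positivity) k
  rw [div_le_iff₀ (by positivity), mul_pow] at hexp
  rw [Real.exp_neg, ← div_eq_mul_inv, div_le_div_iff₀ (Real.exp_pos _) (by positivity)]
  linarith

lemma half_le_mul_log_div {s d : ℕ} (hs : 1 ≤ s) (hsd : s < d) :
    1 / 2 ≤ (s : ℝ) * Real.log (d / s) := by
  have hs₀ : (1 : ℝ) ≤ s := Nat.one_le_cast.2 hs
  have hd : (s : ℝ) + 1 ≤ d := by exact_mod_cast hsd
  calc (1 : ℝ) / 2 ≤ s * (1 - ((s + 1 : ℝ) / s)⁻¹) := by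
        rw [inv_div]; field_simp; linarith
    _ ≤ s * Real.log ((s + 1 : ℝ) / s) := by
        gcongr; exact Real.one_sub_inv_le_log_of_pos (by positivity)
    _ ≤ s * Real.log (d / s) := by gcongr

lemma natCast_mul_pow_le {n d s : ℕ} (hs : 1 ≤ s) (hsn : s < n) (hsd : s < d) (j : ℕ) :
    ((n : ℝ) * d) ^ j ≤ n ^ (2 * j) * Real.exp (j * (s * Real.log (d / s))) := by
  have hs₀ : (1 : ℝ) ≤ s := Nat.one_le_cast.2 hs
  have hd₀ : (0 : ℝ) < d := Nat.cast_pos.2 (by lia)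
  have hratio : (d : ℝ) / s ≤ Real.exp (s * Real.log (d / s)) := by
    refine (Real.log_le_iff_le_exp (by positivity)).1 (le_mul_of_one_le_left ?_ hs₀)
    exact Real.log_nonneg ((one_le_div (by positivity)).2 (Nat.cast_le.2 hsd.le))
  calc ((n : ℝ) * d) ^ j = (n * s * (d / s)) ^ j := by field_simp
    _ ≤ (n * n * Real.exp (s * Real.log (d / s))) ^ j := by gcongr
    _ = n ^ (2 * j) * Real.exp (j * (s * Real.log (d / s))) := by
        rw [mul_pow, ← Real.exp_nat_mul, pow_mul, sq]

lemma exists_le_mul_log_div {M α : ℝ} (hM : 0 < M) (hα : 0 < α) (j : ℕ) :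
    ∃ C : ℝ, 0 < C ∧ ∀ {n d s : ℕ} {x : ℝ}, 1 ≤ s → s < n → s < d → x ≤ 1 →
      x ≤ M * (n * d) ^ j * Real.exp (-(α * n)) → x ≤ C * (s * Real.log (d / s) / n) := by
  set F : ℝ := (2 * j + 1).factorial / (α / 2) ^ (2 * j + 1)
  have hF : 0 < F := by positivity
  refine ⟨2 * M * F + 2 * j / α, by positivity, fun {n d s x} hs hsn hsd hx₁ hx => ?_⟩
  have hn : (0 : ℝ) < n := Nat.cast_pos.2 (by lia)
  have hrate := half_le_mul_log_div hs hsd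
  have hpow := natCast_mul_pow_le hs hsn hsd j
  set Λ : ℝ := s * Real.log (d / s)
  rw [← mul_div_assoc, le_div_iff₀ hn, add_mul]
  -- If `j * Λ` is small then `(n * d) ^ j` costs half of the exponential decay; otherwise `Λ / n`
  -- is bounded below and `x ≤ 1` suffices.
  rcases le_total (j * Λ) (α / 2 * n) with hj | hj
  · calc x * n ≤ M * (n ^ (2 * j) * Real.exp (α / 2 * n)) * Real.exp (-(α * n)) * n := by
          gcongr
          exact hx.trans (by gcongr; exact hpow.trans (by gcongr))
      _ = M * (n ^ (2 * j + 1) * Real.exp (-(α / 2 * n))) := by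
          rw [show -(α / 2 * n) = α / 2 * n + -(α * n) by ring, Real.exp_add]; ring
      _ ≤ M * F := by gcongr; exact pow_mul_exp_neg_mul_le (by positivity) hn.le _
      _ ≤ 2 * M * F * Λ := by nlinarith [mul_pos hM hF]
      _ ≤ 2 * M * F * Λ + 2 * j / α * Λ := le_add_of_nonneg_right (by positivity)
  · calc x * n ≤ n := mul_le_of_le_one_left hn.le hx₁
      _ ≤ 2 * j / α * Λ := by rw [div_mul_eq_mul_div, le_div_iff₀ hα]; linarith
      _ ≤ 2 * M * F * Λ + 2 * j / α * Λ := le_add_of_nonneg_left (by positivity)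

lemma HingeConditions.exists_integral_gibbs_real_compl_ball_le {L K B C₁ Cx w r : ℝ} (hL : 0 < L)
    (hK : 0 < K) (hC₁ : 0 < C₁) (hCx : 0 < Cx) (hw : 0 < w) (hBw : B ≤ w)
    (hKw : 2 * L ^ 2 * K ≤ w) (hr : 0 < r) :
    ∃ C : ℝ, 0 < C ∧ ∀ {n d : ℕ} {P : Measure (Obs d)} [IsProbabilityMeasure P] {θs : Vec d}
      {τ : ℝ}, HingeConditions P θs L K B C₁ → IsAdmissibleScale n C₁ Cx τ θs →
      1 ≤ l0 θs → l0 θs < n → l0 θs < d →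
      ∫ D, (gibbs C₁ τ (n / w) D).real (Metric.ball θs r)ᶜ ∂sampleLaw P n ≤
        C * (l0 θs * Real.log (d / l0 θs) / n) := by
  set ε : ℝ := r ^ 2 / (4 * K * L)
  have hε : 0 < ε := by positivity
  set k : ℕ := ⌊(C₁ / ε) ^ 2⌋₊ with hk
  set M : ℝ := 4 / 3 * (2 + 2 * (C₁ * Cx) ^ 2) ^ (2 * k) * Real.exp (4 * L / (w * Cx)) with hM
  obtain ⟨C, hC, hrate⟩ := exists_le_mul_log_div (M := M) (α := r ^ 2 / (4 * K * w))
    (by positivity) (by positivity) (4 * k)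
  refine ⟨C, hC, fun {n d P _ θs τ} h hτ hs hsn hsd => hrate hs hsn hsd ?_ ?_⟩
  · exact (integral_mono (integrable_gibbs_real (hτ.pos hCx (by lia) (by lia)) hC₁ _ _ _)
      (integrable_const 1) fun D => measureReal_le_one).trans_eq (by simp)
  have hn : 0 < n := by lia
  obtain ⟨A, hA, hAC, hAε, hm⟩ := hτ.exists_one_le_mul_prior hC₁ hCx hn (by lia) h.target_mem hε
  refine (h.integral_gibbs_real_compl_ball_le hL.le hK hC₁ (hτ.pos hCx hn (by lia)) hw hBw hKw
    hn.ne' hr.le hA hAC hAε hm).trans_eq ?_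
  have hexp : n / w * (L * (ε + 4 / (Cx * n)) - r ^ 2 / (2 * K)) =
      4 * L / (w * Cx) + -(r ^ 2 / (4 * K * w) * n) := by
    simp only [ε]; field_simp; ring
  rw [hexp, Real.exp_add, hM, ← hk, mul_pow (2 + 2 * (C₁ * Cx) ^ 2), ← pow_mul,
    show 2 * (2 * k) = 4 * k by ring]
  ring

end ScaleAndRate

section ExcessRisk

lemma integral_sub_le {Ω : Type*} [MeasurableSpace Ω] {μ : Measure Ω} [IsProbabilityMeasure μ]
    {f g : Ω → ℝ} {b c : ℝ} (hf : ∀ ω, 0 ≤ f ω) (hfg : ∀ ω, f ω ≤ b + g ω) (hg : Integrable g μ)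
    (hc : ∫ ω, g ω ∂μ ≤ c) : ∫ ω, f ω ∂μ - b ≤ c := by
  rw [sub_le_iff_le_add']
  calc ∫ ω, f ω ∂μ ≤ ∫ ω, b + g ω ∂μ := integral_mono_of_nonneg (.of_forall hf)
        ((integrable_const b).add hg) (.of_forall hfg)
    _ = b + ∫ ω, g ω ∂μ := by rw [integral_add (integrable_const b) hg]; simp
    _ ≤ b + c := by gcongr

lemma apply_posteriorMean_le {d n : ℕ} {C₁ τ lam r b : ℝ} {D : Fin n → Obs d}
    [IsProbabilityMeasure (gibbs C₁ τ lam D)] {R : Vec d → ℝ} {θs : Vec d}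
    (hθs : θs ∈ ballL1 d C₁) (hr : 0 < r) (hR : ∀ θ, R θ ≤ 1) (hb : 0 ≤ b)
    (hRb : ∀ θ, ‖θ - θs‖ < 2 * r → R θ ≤ b) :
    R (posteriorMean C₁ τ lam D) ≤
      b + 2 * C₁ / r * (gibbs C₁ τ lam D).real (Metric.ball θs r)ᶜ := by
  have hC₁ : 0 ≤ C₁ := (l1_nonneg θs).trans hθs
  have hnorm : ‖posteriorMean C₁ τ lam D - θs‖ ≤
      r + 2 * C₁ * (gibbs C₁ τ lam D).real (Metric.ball θs r)ᶜ :=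
    norm_integral_id_sub_le hr.le <|
      (ae_gibbs_mem_ballL1 C₁ τ lam D).mono fun θ hθ => norm_sub_le_of_mem_ballL1 hθ hθs
  rcases lt_or_ge (2 * C₁ * (gibbs C₁ τ lam D).real (Metric.ball θs r)ᶜ) r with h | h
  · exact (hRb _ (by linarith)).trans (le_add_of_nonneg_right (by positivity))
  · have hone : 1 ≤ 2 * C₁ / r * (gibbs C₁ τ lam D).real (Metric.ball θs r)ᶜ := by
      rwa [div_mul_eq_mul_div, one_le_div hr]
    exact (hR _).trans (hone.trans (le_add_of_nonneg_left hb))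

lemma integral_gibbs_sub_le_and_posteriorMean {d n : ℕ} {P : Measure (Obs d)}
    [IsProbabilityMeasure P] {C₁ τ lam r b c : ℝ} {R : Vec d → ℝ} {θs : Vec d} (hτ : 0 < τ)
    (hC₁ : 0 < C₁) (hlam : 0 ≤ lam) (hθs : θs ∈ ballL1 d C₁) (hr : 0 < r) (hR₀ : ∀ θ, 0 ≤ R θ)
    (hR₁ : ∀ θ, R θ ≤ 1) (hb : 0 ≤ b) (hRb : ∀ θ, ‖θ - θs‖ < 2 * r → R θ ≤ b)
    (hc : ∫ D : Fin n → Obs d, (gibbs C₁ τ lam D).real (Metric.ball θs r)ᶜ ∂sampleLaw P n ≤ c) :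
    (∫ D : Fin n → Obs d, ∫ θ, R θ ∂gibbs C₁ τ lam D ∂sampleLaw P n) - b ≤
        (1 + 2 * C₁ / r) * c ∧
      (∫ D : Fin n → Obs d, R (posteriorMean C₁ τ lam D) ∂sampleLaw P n) - b ≤
        (1 + 2 * C₁ / r) * c := by
  have hprob (D : Fin n → Obs d) : IsProbabilityMeasure (gibbs C₁ τ lam D) :=
    isProbabilityMeasure_gibbs hτ hC₁ hlam D
  have hfar : ∫ D : Fin n → Obs d, (1 + 2 * C₁ / r) *
      (gibbs C₁ τ lam D).real (Metric.ball θs r)ᶜ ∂sampleLaw P n ≤ (1 + 2 * C₁ / r) * c := by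
    rw [integral_const_mul]
    gcongr
  have hint := (integrable_gibbs_real (n := n) hτ hC₁ lam (Metric.ball θs r)ᶜ P).const_mul
    (1 + 2 * C₁ / r)
  constructor
  · refine integral_sub_le (fun D => integral_nonneg hR₀) (fun D => ?_) hint hfar
    refine (integral_le_add_mul_measureReal_compl (s := Metric.ball θs r)
      Metric.isOpen_ball.measurableSet hR₀ hb
      (fun θ hθ => hRb θ ?_) (.of_forall hR₁)).trans ?_
    · exact (mem_ball_iff_norm.1 hθ).trans (by linarith)
    · gcongr
      exact le_add_of_nonneg_right (by positivity)
  · refine integral_sub_le (fun D => hR₀ _) (fun D => ?_) hint hfar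
    refine (apply_posteriorMean_le hθs hr hR₁ hb hRb).trans ?_
    gcongr
    exact le_add_of_nonneg_left zero_le_one

variable {L K B C₁ Cx w : ℝ}

lemma HingeConditions.misclassRisk_le_bayesRisk {d : ℕ} {P : Measure (Obs d)}
    [IsProbabilityMeasure P] {θs : Vec d} (h : HingeConditions P θs L K B C₁) (hL : 0 < L)
    (hC₁ : 0 < C₁) {θ : Vec d} (hθ : θs = 0 ∨ ‖θ - θs‖ < 1 / (2 * L)) :
    misclassRisk P θ ≤ bayesRisk P := by
  have hint := h.integrable_hinge h.target_mem
  rcases hθ with rfl | hθ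
  · refine h.isHingeBayes.misclassRisk_le_bayesRisk hint h.abs_label (.of_forall fun z hz => ?_)
    norm_num at hz
  · exact h.isHingeBayes.misclassRisk_le_bayesRisk_of_norm_sub_lt hint h.abs_label hL
      (h.ae_norm_le hL.le hC₁) hθ

lemma HingeConditions.exists_integral_risk_sub_bayesRisk_le (hL : 0 < L) (hK : 0 < K)
    (hC₁ : 0 < C₁) (hCx : 0 < Cx) (hw : 0 < w) (hBw : B ≤ w) (hKw : 2 * L ^ 2 * K ≤ w) :
    ∃ C : ℝ, 0 < C ∧ ∀ {n d : ℕ} {P : Measure (Obs d)} [IsProbabilityMeasure P] {θs : Vec d}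
      {τ : ℝ} {R : Vec d → ℝ}, HingeConditions P θs L K B C₁ → IsAdmissibleScale n C₁ Cx τ θs →
      l0 θs < n → l0 θs < d → (∀ θ, 0 ≤ R θ) → (∀ θ, R θ ≤ misclassRisk P θ) →
      (∫ D, ∫ θ, R θ ∂gibbs C₁ τ (n / w) D ∂sampleLaw P n) - bayesRisk P ≤
          C * (l0 θs * Real.log (d / l0 θs) / n) ∧
        (∫ D, R (posteriorMean C₁ τ (n / w) D) ∂sampleLaw P n) - bayesRisk P ≤
          C * (l0 θs * Real.log (d / l0 θs) / n) := by
  set r : ℝ := 1 / (4 * L) with hr_def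
  have hr : 0 < r := by positivity
  obtain ⟨C, hC, hconc⟩ := exists_integral_gibbs_real_compl_ball_le hL hK hC₁ hCx hw hBw hKw hr
  refine ⟨(1 + 2 * C₁ / r) * C, by positivity, ?_⟩
  intro n d P _ θs τ R h hτ hsn hsd hR₀ hR
  have hτ₀ : 0 < τ := hτ.pos hCx (by lia) (by lia)
  have hlam : 0 ≤ n / w := by positivity
  rcases (l0 θs).eq_zero_or_pos with hs | hs
  · have hRb (θ : Vec d) : R θ ≤ bayesRisk P :=
      (hR θ).trans (h.misclassRisk_le_bayesRisk hL hC₁ (.inl (eq_zero_of_l0_eq_zero hs)))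
    have hprob (D : Fin n → Obs d) := isProbabilityMeasure_gibbs hτ₀ hC₁ hlam D
    constructor
    · refine integral_sub_le (g := 0) (fun D => integral_nonneg hR₀) (fun D => ?_)
        (integrable_zero _ _ _) (by simp [hs])
      exact (integral_mono_of_nonneg (.of_forall hR₀) (integrable_const _)
        (.of_forall hRb)).trans_eq (by simp)
    · exact integral_sub_le (g := 0) (fun D => hR₀ _) (fun D => (hRb _).trans_eq (by simp))
        (integrable_zero _ _ _) (by simp [hs])
  · have hR₁ (θ : Vec d) : R θ ≤ 1 := (hR θ).trans measureReal_le_one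
    have hRb (θ : Vec d) (hθ : ‖θ - θs‖ < 2 * r) : R θ ≤ bayesRisk P :=
      (hR θ).trans (h.misclassRisk_le_bayesRisk hL hC₁ (.inr (hθ.trans_eq (by
        rw [hr_def]; field_simp; norm_num))))
    simp only [mul_assoc]
    exact integral_gibbs_sub_le_and_posteriorMean hτ₀ hC₁ hlam h.target_mem hr hR₀ hR₁
      measureReal_nonneg hRb (hconc h hτ hs hsn hsd)

end ExcessRisk

end SparseClassification

end

open SparseClassification in
theorem theorem3_general (L K B C₁ Cx w : ℝ) (hL : 0 < L) (hK : 0 < K) (hC₁ : 0 < C₁)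
    (hCx : 0 < Cx) (hw : max (2 * L ^ 2 * K) B ≤ w) :
    ∃ C : ℝ, 0 < C ∧
      ∀ (n d : ℕ) (P : Measure (Obs d)) [IsProbabilityMeasure P] (θs : Vec d) (τ : ℝ),
        HingeConditions P θs L K B C₁ →
        IsAdmissibleScale n C₁ Cx τ θs →
        l0 θs < n →
        l0 θs < d →
        ((∫ D, (∫ θ, misclassRisk P θ ∂(gibbs C₁ τ (n / w) D)) ∂(sampleLaw P n)) - bayesRisk P
            ≤ C * (l0 θs * Real.log (d / l0 θs) / n) ∧
          (∫ D, (∫ θ, predictionRisk P θ ∂(gibbs C₁ τ (n / w) D)) ∂(sampleLaw P n)) - bayesRisk P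
            ≤ C * (l0 θs * Real.log (d / l0 θs) / n)) ∧
        ((∫ D, misclassRisk P (posteriorMean C₁ τ (n / w) D) ∂(sampleLaw P n)) - bayesRisk P
            ≤ C * (l0 θs * Real.log (d / l0 θs) / n) ∧
          (∫ D, predictionRisk P (posteriorMean C₁ τ (n / w) D) ∂(sampleLaw P n)) - bayesRisk P
            ≤ C * (l0 θs * Real.log (d / l0 θs) / n)) := by
  have hKw : 2 * L ^ 2 * K ≤ w := (le_max_left _ _).trans hw
  obtain ⟨C, hC, hbound⟩ := HingeConditions.exists_integral_risk_sub_bayesRisk_le hL hK hC₁ hCx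
    (lt_of_lt_of_le (by positivity) hKw) ((le_max_right _ _).trans hw) hKw
  refine ⟨C, hC, fun n d P _ θs τ h hτ hsn hsd => ?_⟩
  have hmis := hbound h hτ hsn hsd (fun _ => measureReal_nonneg) fun _ => le_rfl
  have hpred := hbound h hτ hsn hsd (fun _ => measureReal_nonneg)
    fun θ => predictionRisk_le_misclassRisk P θ
  exact ⟨⟨hmis.1, hpred.1⟩, ⟨hmis.2, hpred.2⟩⟩

open SparseClassification in
theorem theorem3 (L K B C₁ Cx : ℝ) (hL : 0 < L) (hK : 0 < K) (hB : 0 < B) (hC₁ : 0 < C₁)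
    (hCx : 0 < Cx) :
    ∃ C : ℝ, 0 < C ∧
      ∀ (n d : ℕ) (P : Measure (Obs d)) [IsProbabilityMeasure P] (θs : Vec d) (c τ lam : ℝ),
        -- labels, moment condition, high dimension and sparsity
        (∀ᵐ z ∂P, z.2 = 1 ∨ z.2 = -1) →
        Integrable (fun z : Obs d => ‖z.1‖) P →
        (∫ z, ‖z.1‖ ∂P) ≤ Cx →
        n < d →
        l0 θs < n →
        -- the target parameter
        θs ∈ ballL1 d C₁ →
        IsMinOn (hingeRisk P) (ballL1 d C₁) θs →
        IsHingeBayes P θs →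
        -- bounded loss
        (∀ᵐ z ∂P, ∀ θ ∈ ballL1 d C₁, hinge z.2 (inner ℝ θ z.1) ≤ B) →
        -- Lipschitz loss
        (∀ᵐ z ∂P, ∀ θ ∈ ballL1 d C₁, ∀ θ' ∈ ballL1 d C₁,
          |hinge z.2 (inner ℝ θ z.1) - hinge z.2 (inner ℝ θ' z.1)| ≤ L * ‖θ - θ'‖) →
        -- Bernstein condition
        (∀ θ ∈ ballL1 d C₁, ‖θ - θs‖ ^ 2 ≤ K * (hingeRisk P θ - hingeRisk P θs)) →
        -- margin condition
        0 < c →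
        P {z | 0 < |regression P z.1 - 1 / 2| ∧ |regression P z.1 - 1 / 2| < 1 / (2 * c)} = 0 →
        -- tuning parameters
        2 * d * τ < C₁ →
        ((τ = 1 / (Cx * n * √(d : ℝ)) ∧ l1 θs ≤ C₁ - 2 * d * τ) ∨ τ = 1 / (Cx * n * d)) →
        lam = n / max (2 * L ^ 2 * K) B →
        -- the Gibbs posterior
        ((∫ D, (∫ θ, misclassRisk P θ ∂(gibbs C₁ τ lam D)) ∂(sampleLaw P n)) - bayesRisk P
            ≤ C * (l0 θs * Real.log (d / l0 θs) / n) ∧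
          (∫ D, (∫ θ, predictionRisk P θ ∂(gibbs C₁ τ lam D)) ∂(sampleLaw P n)) - bayesRisk P
            ≤ C * (l0 θs * Real.log (d / l0 θs) / n)) ∧
        -- the posterior mean
        ((∫ D, misclassRisk P (posteriorMean C₁ τ lam D) ∂(sampleLaw P n)) - bayesRisk P
            ≤ C * (l0 θs * Real.log (d / l0 θs) / n) ∧
          (∫ D, predictionRisk P (posteriorMean C₁ τ lam D) ∂(sampleLaw P n)) - bayesRisk P
            ≤ C * (l0 θs * Real.log (d / l0 θs) / n)) := by
  obtain ⟨C, hC, hbound⟩ := theorem3_general L K B C₁ Cx _ hL hK hC₁ hCx le_rfl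
  refine ⟨C, hC, ?_⟩
  rintro n d P _ θs c τ _ hlab - - hnd hsn hθs - hbayes hbdd hLip hBern - - hdτ hτ rfl
  have habs : ∀ᵐ z ∂P, |z.2| = 1 := hlab.mono fun z => (abs_eq zero_le_one).2
  exact hbound n d P θs τ ⟨habs, hθs, hbayes, hbdd, hLip, hBern⟩
    (.of_eq_or_eq hCx (by lia) (by lia) hdτ hτ) hsn (hsn.trans hnd)
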